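/- **Setting.** Let $N\ge 2$, and let $1<p<\frac{N+2}{N-2}$ if $N>2$, $1<p<\infty$ if $N=2$. On the hyperbolic space $\mathbb H^N$ use geodesic polar coordinates $(r,\theta)\in[0,\infty)\times\mathbb S^{N-1}$ around a fixed origin, in which the metric is $dr^2+\sinh^2 r\,d\theta^2$. For $R>0$ let $B_R=\{r<R\}$ and $B_R^c=\mathbb H^N\setminus B_R$. Let $dx$ and $ds_x$ denote the hyperbolic volume and surface measures. Let $G$ be a group of isometries of $\mathbb S^{N-1}$. A function $\psi\in H^1(B_R^c)$ is $G$-symmetric if $\psi(r,g\theta)=\psi(r,\theta)$ a.e. for all $g\in G$; these functions form $H^1_G(B_R^c)$. The eigenvalues of $-\Delta_{\mathbb S^{N-1}}$ are $\mu_i=i(i+N-2)$, $i\ge 0$. **(G1)** There is a least $i\ge 1$, denoted $i_1$, for which $\mu_{i}$ is an eigenvalue of $-\Delta_{\mathbb S^{N-1}}$ restricted to $G$-symmetric functions. The multiplicity of $\mu_{i_1}$ in this restricted problem is odd, and $$i_1>\frac{2-N+\sqrt{(N-2)^2+\frac{16}{9}(N+2)(N-1)}}{2}.$$ **The function $z_R$.**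 Put $\lambda=1/R^2$. Let $u_\lambda$ be the unique positive radial solution of $-\lambda\Delta u+u-u^p=0$ in $B_1^c$ with $u=0$ on $\partial B_1$ and $u\to 0$ at infinity. Let $z_\lambda$ be the positive radial $H^1_0(B_1^c)$-eigenfunction, normalized by $\|z_\lambda\|_{L^2(B_1^c)}=1$, of $-\lambda\Delta+1-p\,u_\lambda^{p-1}$ for its unique negative eigenvalue on radial functions. Write $z_\lambda=z_\lambda(r)$ and set $z_R(r,\theta)=z_\lambda(r/R)$. **Lemma.** Suppose that $G$ satisfies (G1) and let $R>0$. Then $$\frac{1}{\sinh R}\int_{\partial B_R}\psi^2\,ds_x\;\le\;\frac{3}{4(N-1)}\int_{B_R^c}|\nabla\psi|^2\,dx$$ for every $\psi\in H^1_G(B_R^c)$ with $\int_{\partial B_R}\psi\,ds_x=0$ and $\int_{B_R^c}\psi\, z_R\,dx=0$, where the values of $\psi$ on $\partial B_R$ are taken in the sense of traces. -/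

import Mathlib

open MeasureTheory Filter Topology Metric
open scoped ContDiff InnerProductSpace RealInnerProductSpace Laplacian

namespace HypExt

/-! ### Hyperbolic space in geodesic normal coordinates at the origin `O`

The point `exp_O x` of `ℍ^N` is represented by the tangent vector `x ∈ T_O ℍ^N = ℝ^N`, so that
`‖x‖` is the geodesic distance to `O` and `x / ‖x‖` is the angular variable `θ ∈ 𝕊^{N-1}`. -/

/-- The tangent space of `ℍ^N` at the origin, used as a global chart of `ℍ^N` through `exp_O`. -/
abbrev E (N : ℕ) : Type := EuclideanSpace ℝ (Fin N)

/-- The unit sphere `𝕊^{N-1}`. -/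
abbrev Sph (N : ℕ) : Type := sphere (0 : E N) 1

/-- The exponential map at `O = (1, 0)` into the hyperboloid
`{(x₀, x') : x₀ ^ 2 - |x'| ^ 2 = 1, x₀ > 0}`: `r θ ↦ (cosh r, sinh r θ)`. -/
noncomputable def expO {N : ℕ} (x : E N) : ℝ × E N :=
  (Real.cosh ‖x‖, (Real.sinh ‖x‖ / ‖x‖) • x)

/-- The hyperbolic metric `dr² + sinh² r dω²` in the exponential chart at a point `x ≠ 0`. -/
noncomputable def hypMetric {N : ℕ} (x v w : E N) : ℝ :=
  (⟪x, v⟫_ℝ / ‖x‖) * (⟪x, w⟫_ℝ / ‖x‖)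
    + (Real.sinh ‖x‖ / ‖x‖) ^ 2 * (⟪v, w⟫_ℝ - (⟪x, v⟫_ℝ / ‖x‖) * (⟪x, w⟫_ℝ / ‖x‖))

/-- The point `expO x` lies on the hyperboloid. -/
lemma expO_mem {N : ℕ} (x : E N) : (expO x).1 ^ 2 - ‖(expO x).2‖ ^ 2 = 1 ∧ 0 < (expO x).1 := by
  refine ⟨?_, Real.cosh_pos _⟩
  by_cases hx : x = 0
  · simp [expO, hx]
  · have h : ‖x‖ ≠ 0 := norm_ne_zero_iff.2 hx
    simp only [expO, norm_smul, norm_div, mul_pow, div_pow, Real.norm_eq_abs, sq_abs]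
    field_simp
    exact Real.cosh_sq_sub_sinh_sq _

/-- The derivative of `expO` away from the origin. -/
lemma hasFDerivAt_expO {N : ℕ} {x : E N} (hx : x ≠ 0) :
    HasFDerivAt expO
      (((Real.sinh ‖x‖) • (‖x‖⁻¹ • innerSL ℝ x)).prod
        ((Real.sinh ‖x‖ / ‖x‖) • ContinuousLinearMap.id ℝ (E N)
          + (((Real.cosh ‖x‖ * ‖x‖ - Real.sinh ‖x‖) / ‖x‖ ^ 2) • (‖x‖⁻¹ • innerSL ℝ x)).smulRight x))
      x := by
  have h : ‖x‖ ≠ 0 := norm_ne_zero_iff.2 hx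
  have hn : HasFDerivAt (fun y : E N => ‖y‖) (‖x‖⁻¹ • innerSL ℝ x) x := by
    have h1 := (hasStrictFDerivAt_norm_sq x).hasFDerivAt.sqrt (by positivity)
    have h2 : (fun y : E N => √(‖y‖ ^ 2)) = fun y => ‖y‖ := by
      funext y; exact Real.sqrt_sq (norm_nonneg y)
    rw [h2, Real.sqrt_sq (norm_nonneg x)] at h1
    refine h1.congr_fderiv ?_
    ext v
    simp only [_root_.smul_apply, innerSL_apply_apply, smul_eq_mul, nsmul_eq_mul]
    push_cast
    field_simp
  refine HasFDerivAt.prodMk ?_ ?_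
  · exact (Real.hasDerivAt_cosh ‖x‖).comp_hasFDerivAt x hn
  · have hq : HasDerivAt (fun r : ℝ => Real.sinh r / r)
        ((Real.cosh ‖x‖ * ‖x‖ - Real.sinh ‖x‖) / ‖x‖ ^ 2) ‖x‖ := by
      refine HasDerivAt.congr_deriv
        (HasDerivAt.fun_div (Real.hasDerivAt_sinh ‖x‖) (hasDerivAt_id' ‖x‖) h) ?_
      rw [mul_one]
    exact (hq.comp_hasFDerivAt x hn).smul (hasFDerivAt_id x)

/-- `hypMetric` is the metric induced on the hyperboloid by `-dx₀² + (dx')²`, read through the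
exponential map. -/
lemma hypMetric_eq_lorentz {N : ℕ} {x : E N} (hx : x ≠ 0) (v w : E N) :
    hypMetric x v w =
      -((fderiv ℝ expO x v).1 * (fderiv ℝ expO x w).1)
        + ⟪(fderiv ℝ expO x v).2, (fderiv ℝ expO x w).2⟫_ℝ := by
  have h : ‖x‖ ≠ 0 := norm_ne_zero_iff.2 hx
  rw [(hasFDerivAt_expO hx).fderiv]
  simp only [hypMetric, ContinuousLinearMap.prod_apply, _root_.smul_apply,
    innerSL_apply_apply, _root_.add_apply, ContinuousLinearMap.id_apply,
    ContinuousLinearMap.smulRight_apply, inner_add_left, inner_add_right, real_inner_smul_left,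
    real_inner_smul_right, smul_eq_mul, real_inner_self_eq_norm_sq]
  rw [real_inner_comm x v]
  have hc : Real.cosh ‖x‖ ^ 2 = 1 + Real.sinh ‖x‖ ^ 2 := by
    have := Real.cosh_sq_sub_sinh_sq ‖x‖; linarith
  field_simp
  ring_nf
  rw [hc]
  ring

/-- The Riemannian gradient at `x ≠ 0` of a function whose differential at `x` (in the chart) is
`v ↦ ⟪ξ, v⟫`. -/
noncomputable def hypGrad {N : ℕ} (x ξ : E N) : E N :=
  (⟪x, ξ⟫_ℝ / ‖x‖ ^ 2) • x
    + (‖x‖ / Real.sinh ‖x‖) ^ 2 • (ξ - (⟪x, ξ⟫_ℝ / ‖x‖ ^ 2) • x)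

/-- `|∇ψ|²` in the hyperbolic metric, for a differential `v ↦ ⟪ξ, v⟫` at `x`. -/
noncomputable def gradSq {N : ℕ} (x ξ : E N) : ℝ := hypMetric x (hypGrad x ξ) (hypGrad x ξ)

/-- The defining property of the gradient. -/
lemma hypMetric_hypGrad {N : ℕ} {x : E N} (hx : x ≠ 0) (ξ v : E N) :
    hypMetric x (hypGrad x ξ) v = ⟪ξ, v⟫_ℝ := by
  have h : ‖x‖ ≠ 0 := norm_ne_zero_iff.2 hx
  have hs : Real.sinh ‖x‖ ≠ 0 := (Real.sinh_pos_iff.2 (norm_pos_iff.2 hx)).ne'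
  simp only [hypMetric, hypGrad, inner_add_left, inner_add_right, inner_smul_left,
    inner_smul_right, inner_sub_left, inner_sub_right, real_inner_self_eq_norm_sq]
  simp
  field_simp
  ring

/-- `|∇ψ|² = (∂_r ψ)² + sinh⁻² r |∇_θ ψ|²` in the exponential chart. -/
lemma gradSq_eq {N : ℕ} {x : E N} (hx : x ≠ 0) (ξ : E N) :
    gradSq x ξ = (⟪x, ξ⟫_ℝ / ‖x‖) ^ 2
      + (‖x‖ / Real.sinh ‖x‖) ^ 2 * (‖ξ‖ ^ 2 - (⟪x, ξ⟫_ℝ / ‖x‖) ^ 2) := by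
  have h : ‖x‖ ≠ 0 := norm_ne_zero_iff.2 hx
  rw [gradSq, hypMetric_hypGrad hx]
  simp only [hypGrad, inner_add_right, inner_smul_right, inner_sub_right,
    real_inner_self_eq_norm_sq, real_inner_comm x ξ]
  field_simp

/-- The Riemannian volume `sinh^{N-1} r dr dθ`; in the exponential chart its density with respect
to Lebesgue measure `r^{N-1} dr dθ` is `(sinh r / r)^{N-1}`. -/
noncomputable def hypVol (N : ℕ) : Measure (E N) :=
  (volume : Measure (E N)).withDensity
    fun x => ENNReal.ofReal ((Real.sinh ‖x‖ / ‖x‖) ^ (N - 1))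

/-- `B_R^c`, up to its boundary sphere (a null set): the points at distance `> R` from `O`. -/
def extBall (N : ℕ) (R : ℝ) : Set (E N) := {x | R < ‖x‖}

/-- The surface measure of `𝕊^{N-1}`. -/
noncomputable def sphMeas (N : ℕ) : Measure (Sph N) := (volume : Measure (E N)).toSphere

/-- The surface measure of the geodesic sphere `∂B_R`, parametrized by `θ ↦ exp_O (R θ)`. -/
noncomputable def bdryMeas (N : ℕ) (R : ℝ) : Measure (Sph N) :=
  ENNReal.ofReal (Real.sinh R ^ (N - 1)) • sphMeas N

/-! ### The Sobolev space `H¹(B_R^c)`, boundary traces, symmetry -/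

/-- `ψ ∈ H¹(B_R^c)` and its weak differential is `v ↦ ⟪Ψ x, v⟫`. Weak differentials do not depend
on the metric, so they are tested in the chart with Lebesgue measure; the `L²` conditions are those
of the hyperbolic metric. -/
structure MemH1 {N : ℕ} (R : ℝ) (ψ : E N → ℝ) (Ψ : E N → E N) : Prop where
  memLp : MemLp ψ 2 ((hypVol N).restrict (extBall N R))
  aesm_grad : AEStronglyMeasurable Ψ ((hypVol N).restrict (extBall N R))
  integrable_grad : Integrable (fun x => gradSq x (Ψ x)) ((hypVol N).restrict (extBall N R))
  weak : ∀ φ : E N → ℝ, ContDiff ℝ ∞ φ → HasCompactSupport φ → tsupport φ ⊆ extBall N R →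
    ∀ v : E N, ∫ x in extBall N R, ψ x * fderiv ℝ φ x v = -∫ x in extBall N R, ⟪Ψ x, v⟫_ℝ * φ x

/-- `t` is the boundary trace of `ψ ∈ H¹(B_R^c)` (with differential `Ψ`) on `∂B_R`: some smooth
compactly supported functions on `ℍ^N` converge to `ψ` in `H¹(B_R^c)` while their restrictions to
`∂B_R` converge to `t` in `L²(∂B_R)`. -/
def IsTrace {N : ℕ} (R : ℝ) (ψ : E N → ℝ) (Ψ : E N → E N) (t : Sph N → ℝ) : Prop :=
  MemLp t 2 (bdryMeas N R) ∧
    ∃ φ : ℕ → E N → ℝ, (∀ n, ContDiff ℝ ∞ (φ n) ∧ HasCompactSupport (φ n)) ∧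
      Tendsto (fun n => ∫ x in extBall N R,
        ((φ n x - ψ x) ^ 2 + gradSq x (gradient (φ n) x - Ψ x)) ∂(hypVol N)) atTop (𝓝 0) ∧
      Tendsto (fun n => ∫ θ : Sph N, (φ n (R • (θ : E N)) - t θ) ^ 2 ∂(bdryMeas N R)) atTop (𝓝 0)

/-- `ψ(r, gθ) = ψ(r, θ)` almost everywhere in `B_R^c`, for all `g ∈ G`. The isometries of
`𝕊^{N-1}` are exactly the restrictions of the linear isometries of `ℝ^N`. -/
def IsSymmetric {N : ℕ} (G : Subgroup (E N ≃ₗᵢ[ℝ] E N)) (R : ℝ) (ψ : E N → ℝ) : Prop :=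
  ∀ g ∈ G, ∀ᵐ x ∂((hypVol N).restrict (extBall N R)), ψ (g x) = ψ x

/-! ### The Laplacian on `G`-symmetric functions on the sphere and hypothesis (G1) -/

/-- The action of a linear isometry on the sphere. -/
noncomputable def sphAct {N : ℕ} (g : E N ≃ₗᵢ[ℝ] E N) (θ : Sph N) : Sph N :=
  ⟨g θ, by have := mem_sphere_zero_iff_norm.1 θ.2; simp [this]⟩

/-- The extension of `f : 𝕊^{N-1} → ℝ` to `ℝ^N ∖ {0}` which is constant along rays. -/
noncomputable def radExt {N : ℕ} (f : Sph N → ℝ) (x : E N) : ℝ :=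
  if hx : x = 0 then 0
  else f ⟨‖x‖⁻¹ • x, by simp [norm_smul, hx]⟩

lemma radExt_add {N : ℕ} (f g : Sph N → ℝ) : radExt (f + g) = radExt f + radExt g := by
  funext x; by_cases hx : x = 0 <;> simp [radExt, hx]

lemma radExt_smul {N : ℕ} (c : ℝ) (f : Sph N → ℝ) : radExt (c • f) = c • radExt f := by
  funext x; by_cases hx : x = 0 <;> simp [radExt, hx]

/-- Smooth functions on the sphere. -/
def SmoothSph {N : ℕ} (f : Sph N → ℝ) : Prop := ContDiffOn ℝ ∞ (radExt f) {0}ᶜ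

/-- The Laplace–Beltrami operator of the unit sphere (on smooth functions): the Euclidean
Laplacian of the radially constant extension, at the points of the sphere. -/
noncomputable def sphLap {N : ℕ} (f : Sph N → ℝ) (θ : Sph N) : ℝ := Δ (radExt f) (θ : E N)

lemma SmoothSph.contDiffAt {N : ℕ} {f : Sph N → ℝ} (hf : SmoothSph f) (θ : Sph N) :
    ContDiffAt ℝ 2 (radExt f) (θ : E N) := by
  have h0 : (θ : E N) ≠ 0 := ne_of_mem_sphere θ.2 one_ne_zero
  have h1 : ContDiffAt ℝ ∞ (radExt f) (θ : E N) :=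
    ContDiffOn.contDiffAt hf (isOpen_compl_singleton.mem_nhds h0)
  exact h1.of_le (WithTop.coe_le_coe.2 (le_top : (2 : ℕ∞) ≤ ⊤))

/-- The `G`-symmetric eigenfunctions of `-Δ_{𝕊^{N-1}}` with eigenvalue `μ`, together with `0`. -/
noncomputable def symEigenspace {N : ℕ} (G : Subgroup (E N ≃ₗᵢ[ℝ] E N)) (μ : ℝ) :
    Submodule ℝ (Sph N → ℝ) where
  carrier := {f | SmoothSph f ∧ (∀ θ, -sphLap f θ = μ * f θ) ∧
    ∀ g ∈ G, ∀ θ, f (sphAct g θ) = f θ}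
  zero_mem' := by
    have h : radExt (0 : Sph N → ℝ) = fun _ => 0 := by
      funext x; by_cases hx : x = 0 <;> simp [radExt, hx]
    refine ⟨?_, ?_, ?_⟩
    · unfold SmoothSph; rw [h]; exact contDiffOn_const
    · intro θ
      simp [sphLap, h]
    · simp
  add_mem' := by
    rintro f₁ f₂ ⟨h₁, e₁, s₁⟩ ⟨h₂, e₂, s₂⟩
    refine ⟨?_, fun θ => ?_, fun g hg θ => ?_⟩
    · unfold SmoothSph; rw [radExt_add]; exact h₁.add h₂
    · have := e₁ θ
      have := e₂ θ
      simp only [sphLap] at *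
      rw [radExt_add, (h₁.contDiffAt θ).laplacian_add (h₂.contDiffAt θ), Pi.add_apply]
      linarith
    · simp [s₁ g hg, s₂ g hg]
  smul_mem' := by
    rintro c f ⟨h, e, s⟩
    refine ⟨?_, fun θ => ?_, fun g hg θ => ?_⟩
    · unfold SmoothSph; rw [radExt_smul]; exact h.const_smul c
    · have := e θ
      simp only [sphLap] at *
      rw [radExt_smul, InnerProductSpace.laplacian_smul c (h.contDiffAt θ), Pi.smul_apply,
        smul_eq_mul, smul_eq_mul]
      linear_combination c * this
    · simp [s g hg]

/-- The `i`-th eigenvalue `μ_i = i (i + N - 2)` of `-Δ_{𝕊^{N-1}}`. -/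
def sphEig (N i : ℕ) : ℝ := (i : ℝ) * ((i : ℝ) + (N : ℝ) - 2)

/-- Hypothesis (G1): if `i₁` is the index of the first nonzero eigenvalue `μ_{i₁}` of
`-Δ_{𝕊^{N-1}}` restricted to `G`-symmetric functions, then its multiplicity there is odd and
`i₁ > (2 - N + √((N-2)² + (16/9)(N+2)(N-1))) / 2`. -/
def G1 {N : ℕ} (G : Subgroup (E N ≃ₗᵢ[ℝ] E N)) : Prop :=
  ∃ i₁ : ℕ, IsLeast {i : ℕ | 1 ≤ i ∧ symEigenspace G (sphEig N i) ≠ ⊥} i₁ ∧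
    Odd (Module.finrank ℝ (symEigenspace G (sphEig N i₁))) ∧
    (2 - (N : ℝ) + √(((N : ℝ) - 2) ^ 2 + 16 / 9 * ((N : ℝ) + 2) * ((N : ℝ) - 1))) / 2 < (i₁ : ℝ)

/-! ### The function `z_R` -/

/-- The Laplacian of `ℍ^N` on radial functions: `f'' + (N - 1) (cosh r / sinh r) f'`. -/
noncomputable def radLap (N : ℕ) (f : ℝ → ℝ) (r : ℝ) : ℝ :=
  deriv (deriv f) r + ((N : ℝ) - 1) * (Real.cosh r / Real.sinh r) * deriv f r

/-- `u = u(r)` is a positive radial solution of `-λ Δu + u - u^p = 0` in `B_1^c`, `u = 0` on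
`∂B_1`, vanishing at infinity. -/
structure IsRadialSolution (N : ℕ) (p lam : ℝ) (u : ℝ → ℝ) : Prop where
  cont : ContinuousOn u (Set.Ici 1)
  smooth : ContDiffOn ℝ 2 u (Set.Ioi 1)
  pos : ∀ r, 1 < r → 0 < u r
  eq : ∀ r, 1 < r → -lam * radLap N u r + u r - u r ^ p = 0
  bdry : u 1 = 0
  infty : Tendsto u atTop (𝓝 0)

/-- `z = z(r)` is the positive radial eigenfunction, in `H_0^1(B_1^c)` and of `L²` norm `1`, for
the negative eigenvalue of the linearized operator `L_λ = -λ Δ + 1 - p u_λ^{p-1}`. -/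
structure IsRadialEigenfunction (N : ℕ) (p lam : ℝ) (z : ℝ → ℝ) : Prop where
  cont : ContinuousOn z (Set.Ici 1)
  smooth : ContDiffOn ℝ 2 z (Set.Ioi 1)
  pos : ∀ r, 1 < r → 0 < z r
  eq : ∃ u : ℝ → ℝ, IsRadialSolution N p lam u ∧ ∃ τ : ℝ, τ < 0 ∧ ∀ r, 1 < r →
    -lam * radLap N z r + z r - p * u r ^ (p - 1) * z r = τ * z r
  bdry : z 1 = 0
  deriv_sq : Integrable (fun x : E N => deriv z ‖x‖ ^ 2) ((hypVol N).restrict (extBall N 1))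
  norm_one : ∫ x in extBall N 1, z ‖x‖ ^ 2 ∂(hypVol N) = 1

open Classical in
/-- The eigenfunction `z_λ` (as a function of `r`). It exists and is unique on `[1, ∞)` for
`λ > 0` and `1 < p < (N + 2) / (N - 2)`. -/
noncomputable def zLam (N : ℕ) (p lam : ℝ) : ℝ → ℝ :=
  if h : ∃ z, IsRadialEigenfunction N p lam z then h.choose else 0

/-- `z_R (x) = z_λ (x / R)` with `λ = 1 / R²`. -/
noncomputable def zR (N : ℕ) (p R : ℝ) (x : E N) : ℝ := zLam N p (1 / R ^ 2) (‖x‖ / R)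

end HypExt

open HypExt

namespace HypExt

/-! Write N = n + 2 and a = 4(N - 1)/3, so that the claim reads (a / sinh R) ∫ t² ≤ ∫ |∇ψ|². For a
test function φ, let Var(r) (`sphVar`) be the squared L² distance on the unit sphere between φ(r·)
and its mean. Since t has mean zero, ∫ t² is controlled by sinh^{N-1} R · Var(R) up to errors that
vanish as φ approaches ψ, and a sinh^n R · Var(R) = -a ∫_R^∞ (sinh^n Var)' dr. It is enough to
dominate -a (sinh^n Var)' by the energy density on each geodesic sphere. The radial energy is at
least -c Var' - c² Var for every c (`radEnergy_ge`), and c = a / sinh r is taken. If φ(r·) had no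
harmonics of degree 1, ..., m with m = i₁ - 1, its angular energy would be at least μ_{i₁} Var
(`angEnergy_ge`). The bound on i₁ in (G1) says exactly μ_{i₁} > a(a - n) (`G1.exists_gap`). The
terms in Var then add up to at least -a n sinh^{n-1} r · Var, and cosh r ≥ 1 concludes
(`energy_ge`). A symmetric ψ has no such harmonics: pairing it with polynomials is a G-invariant
functional, represented in each degree by a symmetric eigenfunction, which is zero in degrees 1,
..., m (`functional_eq_zero`). The approximating φ need not be symmetric, but their low harmonics
are bounded by ∫ (φ - ψ)² (`integral_sphCoef_sq_le`) and disappear in the limit. The spectral gap on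
the sphere is obtained from polynomials. The spherical Laplacian is half the sum of the squares of
the rotation fields, which integrate by parts because the measure is rotation invariant. A
polynomial of degree M + 1 orthogonal to those of degree at most M is an eigenfunction with
eigenvalue μ_{M+1} (`pL_sphT_eq`), and polynomials are dense in L² (`spectral_gap`). -/

/-! ### Invariance of the surface measure and integrals depending on a parameter. -/

instance sphMeas_isFiniteMeasure (N : ℕ) : IsFiniteMeasure (sphMeas N) := by
  unfold sphMeas; infer_instance

instance sphMeas_isOpenPosMeasure (N : ℕ) : (sphMeas N).IsOpenPosMeasure := by
  unfold sphMeas; infer_instance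

lemma continuous_sphAct {N : ℕ} (g : E N ≃ₗᵢ[ℝ] E N) : Continuous (sphAct g) :=
  Continuous.subtype_mk (g.continuous.comp continuous_subtype_val) _

open scoped Pointwise in
/-- The surface measure of the sphere is invariant under linear isometries. -/
lemma measurePreserving_sphAct {N : ℕ} (g : E N ≃ₗᵢ[ℝ] E N) :
    MeasurePreserving (sphAct g) (sphMeas N) (sphMeas N) := by
  refine ⟨(continuous_sphAct g).measurable, ?_⟩
  ext s hs
  rw [Measure.map_apply (continuous_sphAct g).measurable hs, sphMeas,
    Measure.toSphere_apply' _ ((continuous_sphAct g).measurable hs), Measure.toSphere_apply' _ hs]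
  congr 1
  -- `toSphere` measures a set through the volume of the cone over it, so it suffices that forming
  -- cones commutes with g.
  have key : Set.Ioo (0 : ℝ) 1 • ((↑) '' (sphAct g ⁻¹' s) : Set (E N))
      = g ⁻¹' (Set.Ioo (0 : ℝ) 1 • ((↑) '' s : Set (E N))) := by
    ext x
    simp only [Set.mem_smul, Set.mem_image, Set.mem_preimage]
    constructor
    · rintro ⟨c, hc, _, ⟨θ, hθ, rfl⟩, rfl⟩
      exact ⟨c, hc, g θ, ⟨sphAct g θ, hθ, rfl⟩, by simp⟩
    · rintro ⟨c, hc, _, ⟨θ, hθ, rfl⟩, hx⟩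
      refine ⟨c, hc, g.symm θ, ⟨sphAct g.symm θ, ?_, rfl⟩, ?_⟩
      · have : sphAct g (sphAct g.symm θ) = θ := by
          apply Subtype.ext; simp [sphAct]
        rwa [this]
      · apply g.injective
        simp [hx]
  rw [key]
  exact (g.measurePreserving.measure_preimage_emb
    g.toHomeomorph.measurableEmbedding _)

lemma integral_comp_sphAct {N : ℕ} (g : E N ≃ₗᵢ[ℝ] E N) (f : Sph N → ℝ) (hf : Continuous f) :
    ∫ θ, f (sphAct g θ) ∂(sphMeas N) = ∫ θ, f θ ∂(sphMeas N) := by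
  have h := measurePreserving_sphAct g
  rw [← integral_map h.measurable.aemeasurable, h.map_eq]
  exact hf.aestronglyMeasurable

lemma integrable_of_continuous_sph {N : ℕ} {f : Sph N → ℝ} (hf : Continuous f) :
    Integrable f (sphMeas N) :=
  hf.integrable_of_hasCompactSupport (HasCompactSupport.of_compactSpace f)

/-- Differentiation under the integral sign over the sphere. -/
lemma hasDerivAt_integral_sph {N : ℕ} {F F' : ℝ → Sph N → ℝ}
    (hF : ∀ t, Continuous (F t)) (hF' : Continuous (Function.uncurry F'))
    (hd : ∀ t θ, HasDerivAt (fun s => F s θ) (F' t θ) t) (t₀ : ℝ) :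
    HasDerivAt (fun t => ∫ θ, F t θ ∂(sphMeas N)) (∫ θ, F' t₀ θ ∂(sphMeas N)) t₀ := by
  obtain ⟨C, hC⟩ := ((isCompact_closedBall t₀ 1).prod
    (isCompact_univ (X := Sph N))).exists_bound_of_continuousOn hF'.continuousOn
  refine (hasDerivAt_integral_of_dominated_loc_of_deriv_le (bound := fun _ => C)
    (s := ball t₀ 1) (ball_mem_nhds t₀ one_pos) ?_ ?_ ?_ ?_ ?_ ?_).2
  · exact Eventually.of_forall fun t => (hF t).aestronglyMeasurable
  · exact integrable_of_continuous_sph (hF t₀)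
  · exact (hF'.comp (Continuous.prodMk_right t₀)).aestronglyMeasurable
  · exact Eventually.of_forall fun θ t ht =>
      hC (t, θ) ⟨ball_subset_closedBall ht, Set.mem_univ _⟩
  · exact integrable_const _
  · exact Eventually.of_forall fun θ t _ => hd t θ

/-! ### Infinitesimal rotations -/

/-- The infinitesimal rotation `x ↦ x_i e_j - x_j e_i`. -/
noncomputable def rotGen {N : ℕ} (i j : Fin N) : E N →L[ℝ] E N :=
  (EuclideanSpace.proj i : E N →L[ℝ] ℝ).smulRight (EuclideanSpace.single j 1)
    - (EuclideanSpace.proj j : E N →L[ℝ] ℝ).smulRight (EuclideanSpace.single i 1)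

lemma rotGen_apply {N : ℕ} (i j : Fin N) (x : E N) :
    rotGen i j x = x i • EuclideanSpace.single j 1 - x j • EuclideanSpace.single i 1 := by
  simp [rotGen]

lemma inner_rotGen {N : ℕ} (i j : Fin N) (x y : E N) :
    ⟪rotGen i j x, y⟫_ℝ = x i * y j - x j * y i := by
  simp [rotGen_apply, inner_sub_left, inner_smul_left, EuclideanSpace.inner_single_left]

lemma inner_rotGen_comm {N : ℕ} (i j : Fin N) (x y : E N) :
    ⟪rotGen i j x, y⟫_ℝ = -⟪x, rotGen i j y⟫_ℝ := by
  rw [real_inner_comm (rotGen i j y) x, inner_rotGen, inner_rotGen]; ring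

/-- With A the generator, A³ = -A gives exp(tA) = 1 + sin t · A + (1 - cos t) · A², the closed form
used in `rotLin`. It includes i = j, where A = 0. -/
lemma rotGen_cube {N : ℕ} (i j : Fin N) (x : E N) :
    rotGen i j (rotGen i j (rotGen i j x)) = -rotGen i j x := by
  by_cases h : i = j
  · subst h; simp [rotGen_apply]
  · simp [rotGen_apply, h, Ne.symm h]
    abel

/-- The rotation by angle `t` in the plane spanned by `e_i` and `e_j`. -/
noncomputable def rotLin {N : ℕ} (i j : Fin N) (t : ℝ) : E N →ₗ[ℝ] E N :=
  (ContinuousLinearMap.id ℝ (E N) + Real.sin t • rotGen i j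
    + (1 - Real.cos t) • (rotGen i j).comp (rotGen i j) : E N →L[ℝ] E N)

lemma rotLin_apply {N : ℕ} (i j : Fin N) (t : ℝ) (x : E N) :
    rotLin i j t x = x + Real.sin t • rotGen i j x
      + (1 - Real.cos t) • rotGen i j (rotGen i j x) := by
  simp [rotLin]

/-- Only skewness of the generator A and A³ = -A enter: they determine every inner product among x,
Ax and A²x, and sin² + cos² = 1 does the rest. -/
lemma norm_rotLin {N : ℕ} (i j : Fin N) (t : ℝ) (x : E N) : ‖rotLin i j t x‖ = ‖x‖ := by
  have h1 : ⟪x, rotGen i j x⟫_ℝ = 0 := by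
    have := inner_rotGen_comm i j x x
    rw [real_inner_comm] at this; linarith
  have h2 : ⟪rotGen i j x, rotGen i j (rotGen i j x)⟫_ℝ = 0 := by
    have := inner_rotGen_comm i j (rotGen i j x) (rotGen i j x)
    rw [real_inner_comm] at this; linarith
  have h3 : ⟪x, rotGen i j (rotGen i j x)⟫_ℝ = -‖rotGen i j x‖ ^ 2 := by
    have := inner_rotGen_comm i j x (rotGen i j x)
    rw [real_inner_self_eq_norm_sq] at this; linarith
  have h4 : ‖rotGen i j (rotGen i j x)‖ ^ 2 = ‖rotGen i j x‖ ^ 2 := by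
    have := inner_rotGen_comm i j (rotGen i j x) (rotGen i j (rotGen i j x))
    rw [rotGen_cube, inner_neg_right, real_inner_self_eq_norm_sq,
      real_inner_self_eq_norm_sq] at this
    linarith
  have h5 : ‖rotLin i j t x‖ ^ 2 = ‖x‖ ^ 2 := by
    rw [rotLin_apply, norm_add_sq_real, norm_add_sq_real]
    simp only [inner_add_left, inner_smul_left, inner_smul_right, norm_smul, mul_pow, h1, h2, h3,
      h4, Real.norm_eq_abs, sq_abs]
    simp
    linear_combination ‖rotGen i j x‖ ^ 2 * (Real.sin_sq_add_cos_sq t)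
  exact (sq_eq_sq₀ (norm_nonneg _) (norm_nonneg _)).1 h5

/-- `rotLin` as a linear isometry. -/
noncomputable def rotIso {N : ℕ} (i j : Fin N) (t : ℝ) : E N ≃ₗᵢ[ℝ] E N :=
  LinearIsometry.toLinearIsometryEquiv ⟨rotLin i j t, norm_rotLin i j t⟩ rfl

lemma rotIso_apply {N : ℕ} (i j : Fin N) (t : ℝ) (x : E N) :
    rotIso i j t x = x + Real.sin t • rotGen i j x
      + (1 - Real.cos t) • rotGen i j (rotGen i j x) := rotLin_apply i j t x

/-- Infinitesimal rotations integrate to zero over the sphere. -/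
lemma integral_fderiv_rotGen {N : ℕ} (i j : Fin N) {f : E N → ℝ} (hf : ContDiff ℝ 1 f) :
    ∫ θ : Sph N, fderiv ℝ f θ (rotGen i j θ) ∂(sphMeas N) = 0 := by
  have hf' : Continuous (fderiv ℝ f) := hf.continuous_fderiv one_ne_zero
  have h := hasDerivAt_integral_sph (N := N)
    (F := fun t θ => f (θ + Real.sin t • rotGen i j θ
      + (1 - Real.cos t) • rotGen i j (rotGen i j θ)))
    (F' := fun t θ => fderiv ℝ f (θ + Real.sin t • rotGen i j θ
      + (1 - Real.cos t) • rotGen i j (rotGen i j θ))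
      (Real.cos t • rotGen i j θ + Real.sin t • rotGen i j (rotGen i j θ)))
    (fun t => by have := hf.continuous; fun_prop)
    (by
      refine Continuous.clm_apply (hf'.comp (by fun_prop)) (by fun_prop))
    (fun t θ => by
      have h1 : HasDerivAt (fun t => (θ : E N) + Real.sin t • rotGen i j θ
          + (1 - Real.cos t) • rotGen i j (rotGen i j θ))
          (Real.cos t • rotGen i j θ + Real.sin t • rotGen i j (rotGen i j θ)) t := by
        have h2 := ((Real.hasDerivAt_sin t).smul_const (rotGen i j (θ : E N))).const_add (θ : E N)
        have h3 := ((Real.hasDerivAt_cos t).const_sub 1).smul_const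
          (rotGen i j (rotGen i j (θ : E N)))
        rw [neg_neg] at h3
        exact h2.add h3
      exact ((hf.differentiable one_ne_zero).differentiableAt.hasFDerivAt).comp_hasDerivAt t h1) 0
  simp only [Real.sin_zero, Real.cos_zero, sub_self, zero_smul, add_zero, one_smul] at h
  -- The integrand is f composed with a rotation, so the integral is constant in t, whereas `h`
  -- computes its derivative at 0.
  have hc : (fun t : ℝ => ∫ θ : Sph N, f (θ + Real.sin t • rotGen i j θ
      + (1 - Real.cos t) • rotGen i j (rotGen i j θ)) ∂(sphMeas N))
      = fun _ => ∫ θ : Sph N, f θ ∂(sphMeas N) := by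
    funext t
    rw [← integral_comp_sphAct (rotIso i j t) (fun θ => f θ)
      (hf.continuous.comp continuous_subtype_val)]
    refine integral_congr_ae (Eventually.of_forall fun θ => ?_)
    simp only [sphAct, rotIso_apply]
  rw [hc] at h
  exact h.unique (hasDerivAt_const _ _)

/-- Lagrange's identity for the angular part of a covector. -/
lemma sum_inner_rotGen_sq {N : ℕ} (x ξ : E N) :
    ∑ i, ∑ j, ⟪ξ, rotGen i j x⟫_ℝ ^ 2 = 2 * (‖x‖ ^ 2 * ‖ξ‖ ^ 2 - ⟪x, ξ⟫_ℝ ^ 2) := by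
  have h (i j : Fin N) : ⟪ξ, rotGen i j x⟫_ℝ ^ 2
      = x i ^ 2 * ξ j ^ 2 + x j ^ 2 * ξ i ^ 2 - 2 * ((x i * ξ i) * (x j * ξ j)) := by
    rw [real_inner_comm, inner_rotGen]; ring
  simp_rw [h, Finset.sum_sub_distrib, Finset.sum_add_distrib, ← Finset.mul_sum, ← Finset.sum_mul,
    EuclideanSpace.norm_sq_eq, Real.norm_eq_abs, sq_abs]
  have h2 : ⟪x, ξ⟫_ℝ = ∑ i, x i * ξ i := by
    simp [PiLp.inner_apply, mul_comm]
  rw [h2]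
  have h3 : ∑ i, (∑ j, x j ^ 2) * ξ i ^ 2 = (∑ j, x j ^ 2) * ∑ i, ξ i ^ 2 := by
    rw [Finset.mul_sum]
  rw [h3]
  ring

/-! ### Polynomials, rotation fields and the spherical Laplacian. -/

/-- Evaluation of a polynomial at a point of `ℝ^N`. -/
noncomputable def pev {N : ℕ} (p : MvPolynomial (Fin N) ℝ) (x : E N) : ℝ :=
  MvPolynomial.eval (fun i => x i) p

section
variable {N : ℕ}
open MvPolynomial

@[simp] lemma pev_C (c : ℝ) (x : E N) : pev (C c) x = c := by simp [pev]
@[simp] lemma pev_X (i : Fin N) (x : E N) : pev (X i) x = x i := by simp [pev]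
@[simp] lemma pev_one (x : E N) : pev 1 x = 1 := by simp [pev]
@[simp] lemma pev_zero (x : E N) : pev 0 x = 0 := by simp [pev]
@[simp] lemma pev_add (p q : MvPolynomial (Fin N) ℝ) (x : E N) :
    pev (p + q) x = pev p x + pev q x := by simp [pev]
@[simp] lemma pev_sub (p q : MvPolynomial (Fin N) ℝ) (x : E N) :
    pev (p - q) x = pev p x - pev q x := by simp [pev]
@[simp] lemma pev_mul (p q : MvPolynomial (Fin N) ℝ) (x : E N) :
    pev (p * q) x = pev p x * pev q x := by simp [pev]
@[simp] lemma pev_smul (c : ℝ) (p : MvPolynomial (Fin N) ℝ) (x : E N) :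
    pev (c • p) x = c * pev p x := by simp [pev, smul_eval]
@[simp] lemma pev_sum {ι : Type*} (s : Finset ι) (f : ι → MvPolynomial (Fin N) ℝ) (x : E N) :
    pev (∑ i ∈ s, f i) x = ∑ i ∈ s, pev (f i) x := by simp [pev]

lemma hasFDerivAt_pev (p : MvPolynomial (Fin N) ℝ) (x : E N) :
    HasFDerivAt (pev p)
      (∑ k, pev (pderiv k p) x • (EuclideanSpace.proj k : E N →L[ℝ] ℝ)) x := by
  induction p using MvPolynomial.induction_on with
  | C a =>
    have : (pev (C a) : E N → ℝ) = fun _ => a := by funext y; simp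
    rw [this]
    simpa using hasFDerivAt_const a x
  | add p q hp hq =>
    have : (pev (p + q) : E N → ℝ) = fun y => pev p y + pev q y := by funext y; simp
    rw [this]
    refine (hp.add hq).congr_fderiv ?_
    simp [add_smul, Finset.sum_add_distrib]
  | mul_X p i hp =>
    have : (pev (p * X i) : E N → ℝ) = fun y => pev p y * y i := by funext y; simp
    rw [this]
    have hi : HasFDerivAt (fun y : E N => y i) (EuclideanSpace.proj i : E N →L[ℝ] ℝ) x :=
      (EuclideanSpace.proj i : E N →L[ℝ] ℝ).hasFDerivAt
    refine (hp.mul hi).congr_fderiv ?_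
    ext v
    simp [pderiv_X, Pi.single_apply, add_mul, Finset.sum_add_distrib,
      apply_ite (fun q => pev q x), Finset.mul_sum]
    exact Finset.sum_congr rfl fun k _ => by ring

lemma contDiff_pev (p : MvPolynomial (Fin N) ℝ) {n : WithTop ℕ∞} : ContDiff ℝ n (pev p) := by
  induction p using MvPolynomial.induction_on with
  | C a =>
    have : (pev (C a) : E N → ℝ) = fun _ => a := by funext y; simp
    rw [this]; exact contDiff_const
  | add p q hp hq =>
    have : (pev (p + q) : E N → ℝ) = fun y => pev p y + pev q y := by funext y; simp
    rw [this]; exact hp.add hq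
  | mul_X p i hp =>
    have : (pev (p * X i) : E N → ℝ) = fun y => pev p y * y i := by funext y; simp
    rw [this]; exact hp.mul (EuclideanSpace.proj i : E N →L[ℝ] ℝ).contDiff

lemma continuous_pev (p : MvPolynomial (Fin N) ℝ) : Continuous (pev p) :=
  (contDiff_pev p (n := 0)).continuous

lemma fderiv_pev (p : MvPolynomial (Fin N) ℝ) (x v : E N) :
    fderiv ℝ (pev p) x v = ∑ k, pev (pderiv k p) x * v k := by
  rw [(hasFDerivAt_pev p x).fderiv]
  simp

/-- The rotation vector field `X_i ∂_j - X_j ∂_i` acting on polynomials. -/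
noncomputable def rotP (i j : Fin N) : MvPolynomial (Fin N) ℝ →ₗ[ℝ] MvPolynomial (Fin N) ℝ :=
  LinearMap.mulLeft ℝ (X i) ∘ₗ (pderiv j).toLinearMap
    - LinearMap.mulLeft ℝ (X j) ∘ₗ (pderiv i).toLinearMap

lemma rotP_apply (i j : Fin N) (p : MvPolynomial (Fin N) ℝ) :
    rotP i j p = X i * pderiv j p - X j * pderiv i p := rfl

lemma fderiv_pev_rotGen (i j : Fin N) (p : MvPolynomial (Fin N) ℝ) (x : E N) :
    fderiv ℝ (pev p) x (rotGen i j x) = pev (rotP i j p) x := by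
  rw [fderiv_pev, rotP_apply]
  simp [rotGen_apply, mul_sub, Finset.sum_sub_distrib]
  ring

/-- The spherical Laplacian `½ ∑ (X_i ∂_j - X_j ∂_i)²` on polynomials. -/
noncomputable def sphT : MvPolynomial (Fin N) ℝ →ₗ[ℝ] MvPolynomial (Fin N) ℝ :=
  (1 / 2 : ℝ) • ∑ i : Fin N, ∑ j : Fin N, rotP i j ∘ₗ rotP i j

lemma sphT_apply (p : MvPolynomial (Fin N) ℝ) :
    sphT p = (1 / 2 : ℝ) • ∑ i, ∑ j, rotP i j (rotP i j p) := by
  simp [sphT]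

/-- The Euclidean Laplacian on polynomials. -/
noncomputable def lapP (p : MvPolynomial (Fin N) ℝ) : MvPolynomial (Fin N) ℝ :=
  ∑ k, pderiv k (pderiv k p)

lemma pderiv_comm' (i j : Fin N) (p : MvPolynomial (Fin N) ℝ) :
    pderiv i (pderiv j p) = pderiv j (pderiv i p) := by
  induction p using MvPolynomial.induction_on with
  | C a => simp
  | add p q hp hq => simp [hp, hq]
  | mul_X p k hp =>
    by_cases hi : i = k <;> by_cases hj : j = k
    · rw [hi, hj]
    · subst hi
      simp [Derivation.leibniz, hp, pderiv_X_of_ne (Ne.symm hj)]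
      ring
    · subst hj
      simp [Derivation.leibniz, hp, pderiv_X_of_ne (Ne.symm hi)]
      ring
    · simp [Derivation.leibniz, hp, pderiv_X_of_ne (Ne.symm hj), pderiv_X_of_ne (Ne.symm hi)]

/-- Terms are repeated instead of carrying a factor 2, and the diagonal correction sits under `if`,
so that the double sum over i, j splits term by term. -/
lemma rotP_rotP (i j : Fin N) (p : MvPolynomial (Fin N) ℝ) :
    rotP i j (rotP i j p) = (if i = j then X i * pderiv i p else 0)
      + (if i = j then X i * pderiv i p else 0)
      + (X i * X i * pderiv j (pderiv j p) + X j * X j * pderiv i (pderiv i p))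
      - (X i * pderiv i p + X j * pderiv j p)
      - (X i * (X j * pderiv i (pderiv j p)) + X i * (X j * pderiv i (pderiv j p))) := by
  simp only [rotP_apply, map_sub, Derivation.leibniz, smul_eq_mul, pderiv_X_self,
    pderiv_comm' j i p]
  by_cases h : i = j
  · subst h; simp; ring
  · rw [pderiv_X_of_ne h, pderiv_X_of_ne (Ne.symm h)]
    simp [h]; ring

/-- Euler's identity, used once for the first-order terms and twice for the mixed second-order ones,
turns everything except |x|²Δ into multiples of p. -/
lemma sphT_of_isHomogeneous {d : ℕ} {p : MvPolynomial (Fin N) ℝ} (hp : p.IsHomogeneous d) :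
    sphT p = (∑ k, X k * X k) * lapP p - sphEig N d • p := by
  have hE : ∑ i, X i * pderiv i p = (d : MvPolynomial (Fin N) ℝ) * p := by
    rw [hp.sum_X_mul_pderiv, nsmul_eq_mul]
  have hEE : ∑ i, ∑ j, X i * (X j * pderiv i (pderiv j p))
      = ((d : MvPolynomial (Fin N) ℝ) * d - d) * p := by
    have h1 (i : Fin N) : X i * pderiv i (∑ j, X j * pderiv j p)
        = X i * pderiv i p + ∑ j, X i * (X j * pderiv i (pderiv j p)) := by
      rw [map_sum]
      simp only [Derivation.leibniz, smul_eq_mul, pderiv_X, Finset.sum_add_distrib]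
      simp [Pi.single_apply, mul_add, Finset.mul_sum]
      ring
    have h2 := Finset.sum_congr rfl fun i (_ : i ∈ (Finset.univ : Finset (Fin N))) => h1 i
    rw [Finset.sum_add_distrib, hE] at h2
    have h3 : ∑ i, X i * pderiv i ((d : MvPolynomial (Fin N) ℝ) * p)
        = (d : MvPolynomial (Fin N) ℝ) * ((d : MvPolynomial (Fin N) ℝ) * p) := by
      conv_rhs => rw [← hE, Finset.mul_sum]
      refine Finset.sum_congr rfl fun i _ => ?_
      simp [Derivation.leibniz]
      ring
    rw [h3] at h2
    linear_combination -h2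
  have hX : ∑ i, ∑ j, (X i * X i * pderiv j (pderiv j p) + X j * X j * pderiv i (pderiv i p))
      = 2 * ((∑ k, X k * X k) * lapP p) := by
    simp_rw [Finset.sum_add_distrib, ← Finset.mul_sum, ← Finset.sum_mul, lapP]
    have : ∑ i, (∑ j, X j * X j) * pderiv i (pderiv i p)
      = (∑ j, X j * X j) * ∑ i, pderiv i (pderiv i p) := by rw [Finset.mul_sum]
    rw [this]; ring
  have h2 : ∑ i, ∑ j, rotP i j (rotP i j p)
      = 2 * ((∑ k, X k * X k) * lapP p - sphEig N d • p) := by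
    simp_rw [rotP_rotP, Finset.sum_sub_distrib, Finset.sum_add_distrib] at hX ⊢
    rw [hX, hEE]
    have h2 : (C 2 : MvPolynomial (Fin N) ℝ) = 2 := map_ofNat C 2
    simp [hE, ← Finset.mul_sum, smul_eq_C_mul, sphEig, h2]
    ring
  rw [sphT_apply, h2, smul_eq_C_mul, ← mul_assoc]
  have : (C (1 / 2 : ℝ) : MvPolynomial (Fin N) ℝ) * 2 = 1 := by
    rw [show (2 : MvPolynomial (Fin N) ℝ) = C 2 from (map_ofNat C 2).symm, ← C_mul]; norm_num
  rw [this, one_mul]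

lemma rotP_isHomogeneous {d : ℕ} {p : MvPolynomial (Fin N) ℝ} (hp : p.IsHomogeneous d)
    (i j : Fin N) : (rotP i j p).IsHomogeneous d := by
  rw [rotP_apply]
  rcases d with _ | d
  · rw [totalDegree_eq_zero_iff_eq_C.1 (Nat.le_zero.1 hp.totalDegree_le)]
    simpa using isHomogeneous_zero _ _ _
  · have h (a b : Fin N) : (X a * pderiv b p).IsHomogeneous (d + 1) := by
      rw [add_comm]
      exact (isHomogeneous_X ℝ a).mul hp.pderiv
    exact (h i j).sub (h j i)

lemma sphT_isHomogeneous {d : ℕ} {p : MvPolynomial (Fin N) ℝ} (hp : p.IsHomogeneous d) :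
    (sphT p).IsHomogeneous d := by
  rw [sphT_apply, smul_eq_C_mul]
  exact (IsHomogeneous.sum _ _ _ fun i _ => IsHomogeneous.sum _ _ _ fun j _ =>
    rotP_isHomogeneous (rotP_isHomogeneous hp i j) i j).C_mul _

lemma eq_sum_homogeneousComponent {M : ℕ} {p : MvPolynomial (Fin N) ℝ} (hp : p.totalDegree ≤ M) :
    p = ∑ i ∈ Finset.range (M + 1), homogeneousComponent i p := by
  conv_lhs => rw [← sum_homogeneousComponent p]
  refine Finset.sum_subset (Finset.range_mono (by omega)) fun i _ hi => ?_
  exact homogeneousComponent_eq_zero _ _ (by simpa [Nat.lt_succ_iff] using hi)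

lemma totalDegree_map_le {Φ : MvPolynomial (Fin N) ℝ →ₗ[ℝ] MvPolynomial (Fin N) ℝ}
    (hΦ : ∀ d p, p.IsHomogeneous d → (Φ p).IsHomogeneous d) {M : ℕ}
    {p : MvPolynomial (Fin N) ℝ} (hp : p.totalDegree ≤ M) : (Φ p).totalDegree ≤ M := by
  rw [eq_sum_homogeneousComponent hp, map_sum]
  refine totalDegree_finsetSum_le fun i hi => ?_
  exact (hΦ i _ (homogeneousComponent_isHomogeneous _ _)).totalDegree_le.trans
    (Nat.lt_succ_iff.1 (Finset.mem_range.1 hi))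

lemma totalDegree_sphT_le {M : ℕ} {p : MvPolynomial (Fin N) ℝ} (hp : p.totalDegree ≤ M) :
    (sphT p).totalDegree ≤ M :=
  totalDegree_map_le (fun _ _ h => sphT_isHomogeneous h) hp

/-- Modulo `|x|² = 1` and lower degree, `sphT` acts on degree `M` as `-μ_M`. -/
lemma exists_sphT_add_eq {M : ℕ} {p : MvPolynomial (Fin N) ℝ} (hp : p.totalDegree ≤ M + 1) :
    ∃ r : MvPolynomial (Fin N) ℝ, r.totalDegree ≤ M ∧
      ∀ θ : Sph N, pev (sphT p + sphEig N (M + 1) • p) θ = pev r θ := by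
  set h := homogeneousComponent (M + 1) p
  set q := ∑ i ∈ Finset.range (M + 1), homogeneousComponent i p
  have hh : h.IsHomogeneous (M + 1) := homogeneousComponent_isHomogeneous _ _
  have hpq : p = q + h := by
    conv_lhs => rw [eq_sum_homogeneousComponent hp, Finset.sum_range_succ]
  have hq : q.totalDegree ≤ M := totalDegree_finsetSum_le fun i hi =>
    (homogeneousComponent_isHomogeneous _ _).totalDegree_le.trans
      (Nat.lt_succ_iff.1 (Finset.mem_range.1 hi))
  -- On the sphere |x|² = 1 replaces |x|²Δh by Δh, of lower degree, and the multiples of h cancel.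
  refine ⟨lapP h + (sphT q + sphEig N (M + 1) • q), ?_, fun θ => ?_⟩
  · refine (totalDegree_add _ _).trans (max_le ?_ ((totalDegree_add _ _).trans (max_le ?_ ?_)))
    · exact totalDegree_finsetSum_le fun k _ =>
        (hh.pderiv.pderiv).totalDegree_le.trans (by omega)
    · exact totalDegree_sphT_le hq
    · exact (totalDegree_smul_le _ _).trans hq
  · rw [hpq, map_add, sphT_of_isHomogeneous hh]
    have h1 : ∑ k, (θ : E N) k * (θ : E N) k = 1 := by
      have := mem_sphere_zero_iff_norm.1 θ.2
      have h2 := EuclideanSpace.norm_sq_eq (θ : E N)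
      rw [this] at h2
      simp only [Real.norm_eq_abs, sq_abs] at h2
      simp_rw [← sq]; linarith
    simp [h1]
    ring

/-! ### Polynomials on the sphere -/

/-- Restriction of polynomials to the sphere. -/
noncomputable def polyC : MvPolynomial (Fin N) ℝ →ₐ[ℝ] C(Sph N, ℝ) :=
  aeval fun i => ⟨fun θ => (θ : E N) i, by fun_prop⟩

lemma polyC_apply (p : MvPolynomial (Fin N) ℝ) (θ : Sph N) : polyC p θ = pev p θ := by
  induction p using MvPolynomial.induction_on with
  | C a => rw [pev_C, polyC, aeval_C]; rfl
  | add p q hp hq => simp [hp, hq]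
  | mul_X p i hp => simp [hp]; simp [polyC]

lemma radExt_polyC (p : MvPolynomial (Fin N) ℝ) {x : E N} (hx : x ≠ 0) :
    radExt (polyC p) x = pev p (‖x‖⁻¹ • x) := by
  simp [radExt, hx, polyC_apply]

lemma smoothSph_polyC (p : MvPolynomial (Fin N) ℝ) : SmoothSph (polyC p : Sph N → ℝ) := by
  have h : ContDiffOn ℝ ∞ (fun x : E N => pev p (‖x‖⁻¹ • x)) {0}ᶜ := by
    intro x hx
    have h1 : ContDiffAt ℝ ∞ (fun x : E N => ‖x‖⁻¹ • x) x :=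
      ((contDiffAt_norm ℝ hx).inv (norm_ne_zero_iff.2 hx)).smul contDiffAt_id
    exact ((contDiff_pev p).contDiffAt.comp x h1).contDiffWithinAt
  exact h.congr fun x hx => radExt_polyC p hx

lemma pev_smul_arg {d : ℕ} {p : MvPolynomial (Fin N) ℝ} (hp : p.IsHomogeneous d) (c : ℝ)
    (x : E N) : pev p (c • x) = c ^ d * pev p x := by
  have h (y : E N) : pev p y = ∑ m ∈ p.support, p.coeff m * ∏ i, y i ^ m i := by
    rw [pev, eval_eq']
  rw [h, h, Finset.mul_sum]
  refine Finset.sum_congr rfl fun m hm => ?_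
  have hd : ∑ i, m i = d := by
    rw [hp.degree_eq_sum_deg_support hm]
    exact (Finset.sum_subset (Finset.subset_univ _) fun i _ hi => by simpa using hi).symm
  simp only [PiLp.smul_apply, smul_eq_mul, mul_pow, Finset.prod_mul_distrib,
    Finset.prod_pow_eq_pow_sum, hd]
  ring

/-- Both terms of the result are again a power of |x|² times a polynomial, so a second application
yields the second derivatives. -/
lemma fderiv_norm_rpow_mul_pev (s : ℝ) (p : MvPolynomial (Fin N) ℝ) {x : E N} (hx : x ≠ 0)
    (k : Fin N) :
    DifferentiableAt ℝ (fun y : E N => (‖y‖ ^ 2) ^ s * pev p y) x ∧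
    fderiv ℝ (fun y : E N => (‖y‖ ^ 2) ^ s * pev p y) x (EuclideanSpace.single k 1)
      = (‖x‖ ^ 2) ^ (s - 1) * pev ((2 * s) • (X k * p)) x
        + (‖x‖ ^ 2) ^ s * pev (pderiv k p) x := by
  have h0 : ‖x‖ ^ 2 ≠ 0 := by positivity
  have h1 : HasFDerivAt (fun y : E N => (‖y‖ ^ 2) ^ s) _ x :=
    (hasStrictFDerivAt_norm_sq x).hasFDerivAt.rpow_const (p := s) (Or.inl h0)
  have h2 : HasFDerivAt (fun y : E N => (‖y‖ ^ 2) ^ s * pev p y) _ x :=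
    h1.mul (hasFDerivAt_pev p x)
  refine ⟨h2.differentiableAt, ?_⟩
  rw [h2.fderiv]
  simp [EuclideanSpace.inner_single_right]
  ring

/-- The radially constant extension of a homogeneous p is |x|^{-d} p, that is (|x|²)^s p with s =
-d/2. Its Euclidean Laplacian on the unit sphere agrees with `sphT` by Euler's identity. -/
lemma sphLap_polyC_of_isHomogeneous {d : ℕ} {p : MvPolynomial (Fin N) ℝ} (hp : p.IsHomogeneous d)
    (θ : Sph N) : sphLap (polyC p : Sph N → ℝ) θ = pev (sphT p) θ := by
  set s : ℝ := -(d : ℝ) / 2 with hs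
  have hθ : ‖(θ : E N)‖ = 1 := mem_sphere_zero_iff_norm.1 θ.2
  have hθ0 : (θ : E N) ≠ 0 := ne_of_mem_sphere θ.2 one_ne_zero
  have hev : ∀ x : E N, x ≠ 0 → radExt (polyC p) x = (‖x‖ ^ 2) ^ s * pev p x := by
    intro x hx
    rw [radExt_polyC p hx, pev_smul_arg hp, ← Real.rpow_natCast ‖x‖ 2, ← Real.rpow_mul (norm_nonneg x), hs,
      inv_pow, ← Real.rpow_natCast ‖x‖ d, ← Real.rpow_neg (norm_nonneg x)]
    congr 2; push_cast; ring
  have hnhds : ∀ x : E N, x ≠ 0 →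
      (radExt (polyC p) : E N → ℝ) =ᶠ[𝓝 x] fun y => (‖y‖ ^ 2) ^ s * pev p y := fun x hx => by
    filter_upwards [isOpen_compl_singleton.mem_nhds hx] with y hy using hev y hy
  have hsm : ContDiffAt ℝ 2 (radExt (polyC p)) (θ : E N) := (smoothSph_polyC p).contDiffAt θ
  have hd1 : DifferentiableAt ℝ (fderiv ℝ (radExt (polyC p))) (θ : E N) :=
    (hsm.fderiv_right (m := 1) (by norm_num)).differentiableAt one_ne_zero
  have hterm (k : Fin N) : iteratedFDeriv ℝ 2 (radExt (polyC p)) (θ : E N)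
      ![EuclideanSpace.single k 1, EuclideanSpace.single k 1]
      = 4 * s * (s - 1) * ((θ : E N) k) ^ 2 * pev p θ + 2 * s * pev p θ
        + 4 * s * ((θ : E N) k * pev (pderiv k p) θ) + pev (pderiv k (pderiv k p)) θ := by
    rw [iteratedFDeriv_two_apply]
    have e1 : fderiv ℝ (fun y => fderiv ℝ (radExt (polyC p)) y (EuclideanSpace.single k 1))
        (θ : E N) (EuclideanSpace.single k 1)
        = fderiv ℝ (fderiv ℝ (radExt (polyC p))) θ (EuclideanSpace.single k 1)
          (EuclideanSpace.single k 1) := by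
      rw [fderiv_clm_apply hd1 (differentiableAt_const _)]
      simp
    simp only [Matrix.cons_val_zero, Matrix.cons_val_one]
    rw [← e1]
    have e2 : (fun y => fderiv ℝ (radExt (polyC p)) y (EuclideanSpace.single k 1))
        =ᶠ[𝓝 (θ : E N)] fun x => (‖x‖ ^ 2) ^ (s - 1) * pev ((2 * s) • (X k * p)) x
        + (‖x‖ ^ 2) ^ s * pev (pderiv k p) x := by
      filter_upwards [isOpen_compl_singleton.mem_nhds hθ0] with y hy
      rw [(hnhds y hy).fderiv_eq, (fderiv_norm_rpow_mul_pev s p hy k).2]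
    rw [e2.fderiv_eq]
    obtain ⟨a1, a2⟩ := fderiv_norm_rpow_mul_pev (s - 1) ((2 * s) • (X k * p)) hθ0 k
    obtain ⟨b1, b2⟩ := fderiv_norm_rpow_mul_pev s (pderiv k p) hθ0 k
    rw [fderiv_fun_add a1 b1, _root_.add_apply, a2, b2, hθ]
    simp [Derivation.leibniz]
    ring
  have hsum : ∑ k, (θ : E N) k ^ 2 = 1 := by
    have h2 := EuclideanSpace.norm_sq_eq (θ : E N)
    rw [hθ] at h2
    simp only [Real.norm_eq_abs, sq_abs] at h2
    linarith
  have hE : ∑ k, (θ : E N) k * pev (pderiv k p) θ = d * pev p θ := by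
    have := congrArg (fun q => pev q (θ : E N)) hp.sum_X_mul_pderiv
    simpa [← Nat.cast_smul_eq_nsmul ℝ] using this
  rw [sphLap, InnerProductSpace.laplacian_eq_iteratedFDeriv_orthonormalBasis _
    (EuclideanSpace.basisFun (Fin N) ℝ)]
  simp only [EuclideanSpace.basisFun_apply, hterm]
  rw [sphT_of_isHomogeneous hp]
  simp_rw [Finset.sum_add_distrib, ← Finset.sum_mul, ← Finset.mul_sum, hE, hsum]
  have hsum' : ∑ k, (θ : E N) k * (θ : E N) k = 1 := by simp_rw [← sq]; exact hsum
  simp [lapP, hsum', sphEig, hs]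
  ring

lemma sphLap_polyC (p : MvPolynomial (Fin N) ℝ) (θ : Sph N) :
    sphLap (polyC p : Sph N → ℝ) θ = pev (sphT p) θ := by
  have key : ∀ (s : Finset ℕ) (f : ℕ → MvPolynomial (Fin N) ℝ), (∀ i ∈ s, (f i).IsHomogeneous i) →
      sphLap (polyC (∑ i ∈ s, f i) : Sph N → ℝ) θ = pev (sphT (∑ i ∈ s, f i)) θ := by
    intro s f
    induction s using Finset.induction_on with
    | empty =>
      intro _
      simpa using sphLap_polyC_of_isHomogeneous (isHomogeneous_zero (Fin N) ℝ 0) θ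
    | insert a s ha ih =>
      intro hf
      have h1 := ih fun i hi => hf i (Finset.mem_insert_of_mem hi)
      have h2 := sphLap_polyC_of_isHomogeneous (hf a (Finset.mem_insert_self a s)) θ
      rw [Finset.sum_insert ha, map_add, map_add, pev_add, ← h1, ← h2]
      simp only [sphLap]
      rw [ContinuousMap.coe_add, radExt_add]
      exact ContDiffAt.laplacian_add ((smoothSph_polyC (f a)).contDiffAt θ)
        ((smoothSph_polyC (∑ i ∈ s, f i)).contDiffAt θ)
  have h := key (Finset.range (p.totalDegree + 1)) (fun i => homogeneousComponent i p)
    fun i _ => homogeneousComponent_isHomogeneous _ _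
  rwa [sum_homogeneousComponent] at h

/-! ### Green's formula and the spectral gap in L² of the sphere. -/

/-- Green's formula on the sphere. -/
lemma integral_sphT_mul (p : MvPolynomial (Fin N) ℝ) {f : E N → ℝ} (hf : ContDiff ℝ 1 f) :
    ∫ θ : Sph N, pev (sphT p) θ * f θ ∂(sphMeas N)
      = -((1 / 2) * ∑ i, ∑ j, ∫ θ : Sph N,
          pev (rotP i j p) θ * fderiv ℝ f θ (rotGen i j θ) ∂(sphMeas N)) := by
  have hfc : Continuous fun θ : Sph N => f θ := hf.continuous.comp continuous_subtype_val
  have hpc (q : MvPolynomial (Fin N) ℝ) : Continuous fun θ : Sph N => pev q θ :=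
    (continuous_pev q).comp continuous_subtype_val
  have hfd (i j : Fin N) : Continuous fun θ : Sph N => fderiv ℝ f θ (rotGen i j θ) := by
    have := hf.continuous_fderiv one_ne_zero
    exact (this.comp continuous_subtype_val).clm_apply (by fun_prop)
  have hij (i j : Fin N) : ∫ θ : Sph N, pev (rotP i j (rotP i j p)) θ * f θ ∂(sphMeas N)
      = -∫ θ : Sph N, pev (rotP i j p) θ * fderiv ℝ f θ (rotGen i j θ) ∂(sphMeas N) := by
    have h := integral_fderiv_rotGen i j ((contDiff_pev (rotP i j p)).mul hf)
    have h2 (x : E N) : fderiv ℝ (fun x => pev (rotP i j p) x * f x) x (rotGen i j x)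
        = pev (rotP i j (rotP i j p)) x * f x
          + pev (rotP i j p) x * fderiv ℝ f x (rotGen i j x) := by
      rw [fderiv_fun_mul ((contDiff_pev _ (n := 1)).differentiable one_ne_zero x)
        (hf.differentiable one_ne_zero x), ← fderiv_pev_rotGen i j (rotP i j p)]
      rw [_root_.add_apply, _root_.smul_apply, _root_.smul_apply, smul_eq_mul, smul_eq_mul]
      ring
    simp_rw [h2] at h
    rw [integral_add] at h
    · linarith
    · exact integrable_of_continuous_sph ((hpc _).mul hfc)
    · exact integrable_of_continuous_sph ((hpc _).mul (hfd i j))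
  simp_rw [sphT_apply, pev_smul, pev_sum, mul_assoc, Finset.sum_mul]
  rw [integral_const_mul, integral_finsetSum]
  · simp_rw [← mul_neg, ← Finset.sum_neg_distrib, ← hij]
    congr 1
    refine Finset.sum_congr rfl fun i _ => ?_
    rw [integral_finsetSum]
    exact fun j _ => integrable_of_continuous_sph ((hpc _).mul hfc)
  · exact fun i _ => integrable_finsetSum _ fun j _ =>
      integrable_of_continuous_sph ((hpc _).mul hfc)

end

/-- The class of a continuous function in `L²(𝕊^{N-1})`. -/
noncomputable def toL2 {N : ℕ} : C(Sph N, ℝ) →L[ℝ] Lp ℝ 2 (sphMeas N) :=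
  ContinuousMap.toLp 2 (sphMeas N) ℝ

lemma inner_toL2 {N : ℕ} (f g : C(Sph N, ℝ)) :
    ⟪toL2 f, toL2 g⟫_ℝ = ∫ θ, f θ * g θ ∂(sphMeas N) := by
  rw [toL2, ContinuousMap.inner_toLp]
  simp [mul_comm]

lemma norm_toL2_sq {N : ℕ} (f : C(Sph N, ℝ)) : ‖toL2 f‖ ^ 2 = ∫ θ, f θ ^ 2 ∂(sphMeas N) := by
  rw [← real_inner_self_eq_norm_sq, inner_toL2]; simp_rw [sq]

lemma toL2_injective {N : ℕ} : Function.Injective (toL2 : C(Sph N, ℝ) → Lp ℝ 2 (sphMeas N)) :=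
  ContinuousMap.toLp_injective _

section
variable {N : ℕ}
open MvPolynomial

/-- The class of a polynomial in `L²(𝕊^{N-1})`. -/
noncomputable def pL : MvPolynomial (Fin N) ℝ →ₗ[ℝ] Lp ℝ 2 (sphMeas N) :=
  toL2.toLinearMap ∘ₗ polyC.toLinearMap

lemma pL_apply (p : MvPolynomial (Fin N) ℝ) : pL p = toL2 (polyC p) := rfl

lemma inner_pL (p q : MvPolynomial (Fin N) ℝ) :
    ⟪pL p, pL q⟫_ℝ = ∫ θ : Sph N, pev p θ * pev q θ ∂(sphMeas N) := by
  rw [pL_apply, pL_apply, inner_toL2]; simp_rw [polyC_apply]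

lemma pL_congr {p q : MvPolynomial (Fin N) ℝ} (h : ∀ θ : Sph N, pev p θ = pev q θ) :
    pL p = pL q := by
  have : polyC p = polyC q := ContinuousMap.ext fun θ => by rw [polyC_apply, polyC_apply, h]
  rw [pL_apply, pL_apply, this]

/-- The surface measure charges every nonempty open set, so continuous functions equal in L² are
equal everywhere. -/
lemma pev_eq_of_pL_eq {p q : MvPolynomial (Fin N) ℝ} (h : pL p = pL q) (θ : Sph N) :
    pev p θ = pev q θ := by
  have h' : polyC p = polyC q := toL2_injective h
  rw [← polyC_apply, ← polyC_apply, h']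

/-- The classes in `L²(𝕊^{N-1})` of the polynomials of degree at most `M`. -/
noncomputable def polyL2 (N M : ℕ) : Submodule ℝ (Lp ℝ 2 (sphMeas N)) :=
  (restrictTotalDegree (Fin N) ℝ M).map pL

instance polyL2_finite (N M : ℕ) : FiniteDimensional ℝ (polyL2 N M) := by
  unfold polyL2; infer_instance

lemma mem_polyL2 {M : ℕ} {x : Lp ℝ 2 (sphMeas N)} :
    x ∈ polyL2 N M ↔ ∃ p : MvPolynomial (Fin N) ℝ, p.totalDegree ≤ M ∧ pL p = x := by
  simp [polyL2, Submodule.mem_map, mem_restrictTotalDegree]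

lemma pL_mem {M : ℕ} {p : MvPolynomial (Fin N) ℝ} (hp : p.totalDegree ≤ M) :
    pL p ∈ polyL2 N M := mem_polyL2.2 ⟨p, hp, rfl⟩

lemma polyL2_mono (N : ℕ) : Monotone (polyL2 N) := fun _ _ h x hx => by
  obtain ⟨p, hp, rfl⟩ := mem_polyL2.1 hx
  exact pL_mem (hp.trans h)

/-- The right side is symmetric in p and q and nonpositive for p = q, which gives self-adjointness
and the sign of `sphT`. -/
lemma inner_pL_sphT (p q : MvPolynomial (Fin N) ℝ) :
    ⟪pL (sphT p), pL q⟫_ℝ = -((1 / 2) * ∑ i, ∑ j, ∫ θ : Sph N,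
      pev (rotP i j p) θ * pev (rotP i j q) θ ∂(sphMeas N)) := by
  rw [inner_pL, integral_sphT_mul p (contDiff_pev q)]
  simp_rw [fderiv_pev_rotGen]

lemma inner_sphT_comm (p q : MvPolynomial (Fin N) ℝ) :
    ⟪pL (sphT p), pL q⟫_ℝ = ⟪pL p, pL (sphT q)⟫_ℝ := by
  rw [inner_pL_sphT, real_inner_comm, inner_pL_sphT]
  simp_rw [mul_comm (pev (rotP _ _ p) _)]

/-- A polynomial of degree `M + 1` orthogonal to those of degree at most `M` is an eigenfunction
of the spherical Laplacian. -/
lemma pL_sphT_eq {M : ℕ} {p : MvPolynomial (Fin N) ℝ} (hp : p.totalDegree ≤ M + 1)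
    (ho : pL p ∈ (polyL2 N M)ᗮ) : pL (sphT p) = -(sphEig N (M + 1) • pL p) := by
  obtain ⟨r, hr, hpr⟩ := exists_sphT_add_eq hp
  have h1 : pL (sphT p) + sphEig N (M + 1) • pL p = pL r := by
    rw [← map_smul, ← map_add]; exact pL_congr hpr
  have h2 (q : MvPolynomial (Fin N) ℝ) (hq : q.totalDegree ≤ M) : ⟪pL p, pL q⟫_ℝ = 0 := by
    rw [real_inner_comm]
    exact ho _ (pL_mem hq)
  -- The remainder r is orthogonal to itself: by self-adjointness ⟨(T + μ)p, r⟩ = ⟨p, (T + μ)r⟩, and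
  -- (T + μ)r has degree at most M.
  have h3 : ⟪pL r, pL r⟫_ℝ = 0 := by
    nth_rewrite 1 [← h1]
    rw [inner_add_left, inner_sphT_comm, inner_smul_left, h2 _ hr,
      h2 _ (totalDegree_sphT_le hr)]
    simp
  rw [inner_self_eq_zero.1 h3] at h1
  exact eq_neg_of_add_eq_zero_left h1

lemma sphEig_mono (hN : 2 ≤ N) {i j : ℕ} (h : i ≤ j) : sphEig N i ≤ sphEig N j := by
  have h1 : (i : ℝ) ≤ j := by exact_mod_cast h
  have h2 : (2 : ℝ) ≤ N := by exact_mod_cast hN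
  unfold sphEig
  have : (0 : ℝ) ≤ i := Nat.cast_nonneg i
  nlinarith

/-- The part of degree at most `M` of a function. -/
lemma exists_pL_eq_starProjection (M : ℕ) (x : Lp ℝ 2 (sphMeas N)) :
    ∃ p : MvPolynomial (Fin N) ℝ, p.totalDegree ≤ M ∧ pL p = (polyL2 N M).starProjection x :=
  mem_polyL2.1 ((polyL2 N M).starProjection_apply_mem x)

/-- The spectral gap for polynomials. -/
lemma spectral_gap_polynomial (hN : 2 ≤ N) {m M : ℕ} (hmM : m ≤ M) :
    ∀ p : MvPolynomial (Fin N) ℝ, p.totalDegree ≤ M →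
      sphEig N (m + 1) * (‖pL p‖ ^ 2 - ‖(polyL2 N m).starProjection (pL p)‖ ^ 2)
        ≤ -⟪pL p, pL (sphT p)⟫_ℝ := by
  induction M, hmM using Nat.le_induction with
  -- The projection fixes p, so the left side is 0, while the Dirichlet form is nonnegative.
  | base =>
    intro p hp
    rw [Submodule.starProjection_eq_self_iff.2 (pL_mem hp), sub_self, mul_zero,
      ← inner_sphT_comm, inner_pL_sphT, neg_neg]
    refine mul_nonneg (by norm_num) (Finset.sum_nonneg fun i _ => Finset.sum_nonneg fun j _ =>
      integral_nonneg fun θ => mul_self_nonneg _)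
  -- Split off the component orthogonal to degree at most M. It is an eigenfunction for μ_{M+1} ≥
  -- μ_{m+1}, and both sides are additive along this splitting.
  | succ M hmM ih =>
    intro p hp
    obtain ⟨q, hq, hqp⟩ := exists_pL_eq_starProjection M (pL p)
    have hy : (p - q).totalDegree ≤ M + 1 :=
      (totalDegree_sub _ _).trans (max_le hp (hq.trans (Nat.le_succ M)))
    have hyo : pL (p - q) ∈ (polyL2 N M)ᗮ := by
      rw [map_sub, hqp]; exact Submodule.sub_starProjection_mem_orthogonal _
    have hyT := pL_sphT_eq hy hyo
    have hort (r : MvPolynomial (Fin N) ℝ) (hr : r.totalDegree ≤ M) :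
        ⟪pL r, pL (p - q)⟫_ℝ = 0 := hyo _ (pL_mem hr)
    have hort' (r : MvPolynomial (Fin N) ℝ) (hr : r.totalDegree ≤ M) :
        ⟪pL (p - q), pL r⟫_ℝ = 0 := by rw [real_inner_comm]; exact hort r hr
    have hp_eq : p = q + (p - q) := by ring
    have hP : (polyL2 N m).starProjection (pL p) = (polyL2 N m).starProjection (pL q) := by
      rw [hp_eq, map_add pL, map_add,
        (Submodule.starProjection_apply_eq_zero_iff _).2
          (Submodule.orthogonal_le (polyL2_mono N hmM) hyo), add_zero]
    have hn : ‖pL p‖ ^ 2 = ‖pL q‖ ^ 2 + ‖pL (p - q)‖ ^ 2 := by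
      conv_lhs => rw [hp_eq, map_add, norm_add_sq_real, hort q hq]
      ring
    have hQ : -⟪pL p, pL (sphT p)⟫_ℝ
        = -⟪pL q, pL (sphT q)⟫_ℝ + sphEig N (M + 1) * ‖pL (p - q)‖ ^ 2 := by
      conv_lhs => rw [hp_eq, map_add, map_add sphT, map_add pL, hyT]
      rw [inner_add_left, inner_add_right, inner_add_right, inner_neg_right, inner_neg_right,
        inner_smul_right, inner_smul_right, hort q hq,
        hort' _ (totalDegree_sphT_le hq), real_inner_self_eq_norm_sq]
      ring
    rw [hP, hn, hQ]
    have h1 := ih q hq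
    have h2 := mul_le_mul_of_nonneg_right (sphEig_mono hN (Nat.succ_le_succ hmM))
      (sq_nonneg ‖pL (p - q)‖)
    linarith

/-- Stone–Weierstrass on the compact sphere (coordinates separate points), followed by density of
continuous functions in L². -/
lemma dense_iSup_polyL2 (N : ℕ) : ⊤ ≤ (⨆ M, polyL2 N M).topologicalClosure := by
  have hsep : (polyC (N := N)).range.SeparatesPoints := by
    intro θ θ' h
    by_contra hcon
    apply h
    ext i
    by_contra hne
    refine hcon ⟨polyC (X i), ⟨polyC (X i), ⟨X i, rfl⟩, rfl⟩, ?_⟩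
    rw [polyC_apply, polyC_apply]
    simpa using hne
  have hd := ContinuousMap.subalgebra_topologicalClosure_eq_top_of_separatesPoints _ hsep
  have hsub : Set.range (toL2 : C(Sph N, ℝ) → Lp ℝ 2 (sphMeas N))
      ⊆ (⨆ M, polyL2 N M).topologicalClosure := by
    rintro _ ⟨f, rfl⟩
    have hf : f ∈ closure ((polyC (N := N)).range : Set C(Sph N, ℝ)) := by
      have : f ∈ (polyC (N := N)).range.topologicalClosure := by rw [hd]; trivial
      exact this
    refine map_mem_closure toL2.continuous hf ?_
    rintro _ ⟨p, rfl⟩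
    exact Submodule.mem_iSup_of_mem p.totalDegree (pL_mem le_rfl)
  have hdense : DenseRange (toL2 : C(Sph N, ℝ) → Lp ℝ 2 (sphMeas N)) :=
    ContinuousMap.toLp_denseRange ℝ (sphMeas N) ℝ (by norm_num)
  intro x _
  exact closure_minimal hsub (Submodule.isClosed_topologicalClosure _) (hdense x)

/-- The spectral gap on the sphere: on functions orthogonal to the polynomials of degree at most
`m`, the Dirichlet form is bounded below by `μ_{m+1}`. -/
lemma spectral_gap (hN : 2 ≤ N) (m : ℕ) {f : E N → ℝ} (hf : ContDiff ℝ 1 f) (c : C(Sph N, ℝ))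
    (hc : ∀ θ : Sph N, c θ = f θ) :
    sphEig N (m + 1) * (‖toL2 c‖ ^ 2 - ‖(polyL2 N m).starProjection (toL2 c)‖ ^ 2)
      ≤ 1 / 2 * ∑ i, ∑ j, ∫ θ : Sph N, fderiv ℝ f θ (rotGen i j θ) ^ 2 ∂(sphMeas N) := by
  have hpc (q : MvPolynomial (Fin N) ℝ) : Continuous fun θ : Sph N => pev q θ :=
    (continuous_pev q).comp continuous_subtype_val
  have hfd (i j : Fin N) : Continuous fun θ : Sph N => fderiv ℝ f θ (rotGen i j θ) := by
    have := hf.continuous_fderiv one_ne_zero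
    exact (this.comp continuous_subtype_val).clm_apply (by fun_prop)
  set x := toL2 c
  have hM (M : ℕ) (hmM : m ≤ M) : sphEig N (m + 1) * (‖(polyL2 N M).starProjection x‖ ^ 2
      - ‖(polyL2 N m).starProjection x‖ ^ 2)
      ≤ 1 / 2 * ∑ i, ∑ j, ∫ θ : Sph N, fderiv ℝ f θ (rotGen i j θ) ^ 2 ∂(sphMeas N) := by
    obtain ⟨p, hp, hpx⟩ := exists_pL_eq_starProjection M x
    have h1 := spectral_gap_polynomial hN hmM p hp
    have h2 : (polyL2 N m).starProjection (pL p) = (polyL2 N m).starProjection x := by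
      rw [hpx]
      exact DFunLike.congr_fun (Submodule.starProjection_comp_starProjection_of_le
        (polyL2_mono N hmM)) x
    rw [h2] at h1
    -- As `sphT p` has degree at most M, it pairs with x only through the projection of x.
    have h3 : ⟪pL (sphT p), x⟫_ℝ = ⟪pL p, pL (sphT p)⟫_ℝ := by
      have : ⟪pL (sphT p), x - pL p⟫_ℝ = 0 := by
        rw [hpx]
        exact Submodule.sub_starProjection_mem_orthogonal x _
          (pL_mem (totalDegree_sphT_le hp))
      rw [inner_sub_right, sub_eq_zero] at this
      rw [this, real_inner_comm]
    have h4 : ⟪pL (sphT p), x⟫_ℝ = -((1 / 2) * ∑ i, ∑ j, ∫ θ : Sph N,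
          pev (rotP i j p) θ * fderiv ℝ f θ (rotGen i j θ) ∂(sphMeas N)) := by
      rw [← integral_sphT_mul p hf, pL_apply, inner_toL2]
      simp_rw [polyC_apply, hc]
    have h5 : ⟪pL p, pL (sphT p)⟫_ℝ = _ := (inner_sphT_comm p p).symm.trans (inner_pL_sphT p p)
    -- A Bessel inequality for the Dirichlet form: expanding the form of f - p, Green's formula
    -- identifies the cross term with that of p, so the form of p is at most that of f.
    have h6 : 0 ≤ 1 / 2 * ∑ i, ∑ j, ∫ θ : Sph N,
        (fderiv ℝ f θ (rotGen i j θ) - pev (rotP i j p) θ) ^ 2 ∂(sphMeas N) :=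
      mul_nonneg (by norm_num) (Finset.sum_nonneg fun i _ => Finset.sum_nonneg fun j _ =>
        integral_nonneg fun θ => sq_nonneg _)
    have h7 (i j : Fin N) : ∫ θ : Sph N,
        (fderiv ℝ f θ (rotGen i j θ) - pev (rotP i j p) θ) ^ 2 ∂(sphMeas N)
        = ∫ θ : Sph N, fderiv ℝ f θ (rotGen i j θ) ^ 2 ∂(sphMeas N)
          - 2 * ∫ θ : Sph N, pev (rotP i j p) θ * fderiv ℝ f θ (rotGen i j θ) ∂(sphMeas N)
          + ∫ θ : Sph N, pev (rotP i j p) θ * pev (rotP i j p) θ ∂(sphMeas N) := by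
      rw [← integral_const_mul, ← integral_sub, ← integral_add]
      · exact integral_congr_ae (Eventually.of_forall fun θ => by simp only; ring)
      · exact integrable_of_continuous_sph (((hfd i j).pow 2).sub
          (continuous_const.mul ((hpc _).mul (hfd i j))))
      · exact integrable_of_continuous_sph ((hpc _).mul (hpc _))
      · exact integrable_of_continuous_sph ((hfd i j).pow 2)
      · exact integrable_of_continuous_sph (continuous_const.mul ((hpc _).mul (hfd i j)))
    simp_rw [h7, Finset.sum_add_distrib, Finset.sum_sub_distrib, ← Finset.mul_sum] at h6
    rw [← hpx]
    linarith
  have hlim : Tendsto (fun M => sphEig N (m + 1) * (‖(polyL2 N M).starProjection x‖ ^ 2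
      - ‖(polyL2 N m).starProjection x‖ ^ 2)) atTop (𝓝 (sphEig N (m + 1) * (‖x‖ ^ 2
      - ‖(polyL2 N m).starProjection x‖ ^ 2))) := by
    have := Submodule.starProjection_tendsto_self (polyL2 N) (polyL2_mono N) x
      (dense_iSup_polyL2 N)
    exact ((this.norm.pow 2).sub_const _).const_mul _
  exact le_of_tendsto hlim ((eventually_ge_atTop m).mono hM)

end

/-! ### Symmetric functions and their low-degree harmonics. -/

section
variable {N : ℕ}
open MvPolynomial

/-- The substitution `p ↦ p ∘ g` on polynomials. -/
noncomputable def substP (g : E N ≃ₗᵢ[ℝ] E N) :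
    MvPolynomial (Fin N) ℝ →ₐ[ℝ] MvPolynomial (Fin N) ℝ :=
  aeval fun i => ∑ j, C (g (EuclideanSpace.single j 1) i) * X j

lemma pev_substP (g : E N ≃ₗᵢ[ℝ] E N) (p : MvPolynomial (Fin N) ℝ) (x : E N) :
    pev (substP g p) x = pev p (g x) := by
  have hx (i : Fin N) : g x i = ∑ j, g (EuclideanSpace.single j 1) i * x j := by
    have h : x = ∑ j, x j • EuclideanSpace.single j (1 : ℝ) := by
      ext i; simp [Pi.single_apply]
    conv_lhs => rw [h, map_sum]
    simp [mul_comm]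
  induction p using MvPolynomial.induction_on with
  | C a => simp [substP, pev]
  | add p q hp hq => simp [hp, hq]
  | mul_X p i hp => rw [map_mul, pev_mul, pev_mul, hp, pev_X, hx]; simp [substP]

lemma totalDegree_substP_le (g : E N ≃ₗᵢ[ℝ] E N) {M : ℕ} {p : MvPolynomial (Fin N) ℝ}
    (hp : p.totalDegree ≤ M) : (substP g p).totalDegree ≤ M := by
  refine totalDegree_map_le (Φ := (substP g).toLinearMap) (fun d q hq => ?_) hp
  have := hq.aeval (n := 1) (fun i => ∑ j, C (g (EuclideanSpace.single j 1) i) * X j)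
    fun i => IsHomogeneous.sum _ _ _ fun j _ => isHomogeneous_C_mul_X _ _
  rwa [one_mul] at this

lemma inner_substP (g : E N ≃ₗᵢ[ℝ] E N) (p q : MvPolynomial (Fin N) ℝ) :
    ⟪pL (substP g p), pL (substP g q)⟫_ℝ = ⟪pL p, pL q⟫_ℝ := by
  rw [inner_pL, inner_pL, ← integral_comp_sphAct g (fun θ => pev p θ * pev q θ)]
  · simp_rw [pev_substP]; rfl
  · exact ((continuous_pev p).comp continuous_subtype_val).mul
      ((continuous_pev q).comp continuous_subtype_val)

lemma pL_substP_symm (g : E N ≃ₗᵢ[ℝ] E N) (p : MvPolynomial (Fin N) ℝ) :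
    pL (substP g (substP g.symm p)) = pL p :=
  pL_congr fun θ => by rw [pev_substP, pev_substP, g.symm_apply_apply]

lemma inner_substP_left (g : E N ≃ₗᵢ[ℝ] E N) (p q : MvPolynomial (Fin N) ℝ) :
    ⟪pL (substP g p), pL q⟫_ℝ = ⟪pL p, pL (substP g.symm q)⟫_ℝ := by
  rw [← pL_substP_symm g q, inner_substP]

/-- The space of spherical harmonics of degree `M + 1`. -/
noncomputable def harmL2 (N M : ℕ) : Submodule ℝ (Lp ℝ 2 (sphMeas N)) :=
  polyL2 N (M + 1) ⊓ (polyL2 N M)ᗮ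

instance harmL2_finite (N M : ℕ) : FiniteDimensional ℝ (harmL2 N M) :=
  Submodule.finiteDimensional_inf_left _ _

lemma substP_mem_harmL2 (g : E N ≃ₗᵢ[ℝ] E N) {M : ℕ} {p : MvPolynomial (Fin N) ℝ}
    (hd : p.totalDegree ≤ M + 1) (hp : pL p ∈ harmL2 N M) : pL (substP g p) ∈ harmL2 N M := by
  refine ⟨pL_mem (totalDegree_substP_le g hd), fun x hx => ?_⟩
  obtain ⟨q, hq, rfl⟩ := mem_polyL2.1 hx
  rw [real_inner_comm, inner_substP_left, real_inner_comm]
  exact hp.2 _ (pL_mem (totalDegree_substP_le _ hq))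

/-- An invariant linear functional on polynomials vanishes on the spherical harmonics of a degree
which carries no invariant eigenfunction. -/
lemma functional_eq_zero_of_mem_harmL2 {G : Subgroup (E N ≃ₗᵢ[ℝ] E N)} {M : ℕ}
    (hG : symEigenspace G (sphEig N (M + 1)) = ⊥)
    (ℓ : MvPolynomial (Fin N) ℝ →ₗ[ℝ] ℝ) (hℓ : ∀ p q, pL p = pL q → ℓ p = ℓ q)
    (hinv : ∀ g ∈ G, ∀ p, ℓ (substP g p) = ℓ p)
    {p : MvPolynomial (Fin N) ℝ} (hp : pL p ∈ harmL2 N M) : ℓ p = 0 := by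
  set b := stdOrthonormalBasis ℝ (harmL2 N M)
  have hb (k) : ∃ q : MvPolynomial (Fin N) ℝ, q.totalDegree ≤ M + 1 ∧ pL q = (b k : Lp ℝ 2 _) :=
    mem_polyL2.1 (b k).2.1
  choose q hq hqb using hb
  -- The Riesz representative of ℓ on the spherical harmonics of degree M + 1.
  set y := ∑ k, ℓ (q k) • q k with hy
  have hrep (z : MvPolynomial (Fin N) ℝ) (hz : pL z ∈ harmL2 N M) : ℓ z = ⟪pL y, pL z⟫_ℝ := by
    have h1 : pL z = pL (∑ k, ⟪(b k : Lp ℝ 2 (sphMeas N)), pL z⟫_ℝ • q k) := by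
      have := congrArg (Subtype.val) (b.sum_repr' ⟨pL z, hz⟩)
      rw [map_sum]
      simp_rw [map_smul, hqb]
      simpa using this.symm
    rw [hℓ _ _ h1, map_sum, hy, map_sum, sum_inner]
    refine Finset.sum_congr rfl fun k _ => ?_
    rw [map_smul, map_smul, real_inner_smul_left, hqb, smul_eq_mul, mul_comm]
  have hyd : y.totalDegree ≤ M + 1 :=
    totalDegree_finsetSum_le fun k _ => (totalDegree_smul_le _ _).trans (hq k)
  have hyH : pL y ∈ harmL2 N M := by
    rw [hy, map_sum]
    refine Submodule.sum_mem _ fun k _ => ?_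
    rw [map_smul, hqb]
    exact Submodule.smul_mem _ _ (b k).2
  -- Invariance of ℓ makes y ∘ g represent it too. The difference y ∘ g - y is then orthogonal to
  -- all harmonics of this degree, itself among them.
  have hfix (g) (hg : g ∈ G) : pL (substP g y) = pL y := by
    have hz (z : MvPolynomial (Fin N) ℝ) (hzd : z.totalDegree ≤ M + 1) (hz : pL z ∈ harmL2 N M) :
        ⟪pL (substP g y) - pL y, pL z⟫_ℝ = 0 := by
      have h1 := hinv _ (G.inv_mem hg) z
      rw [inner_sub_left, inner_substP_left, ← hrep z hz,
        ← hrep _ (substP_mem_harmL2 g.symm hzd hz), ← h1]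
      exact sub_self _
    have h2 := hz (substP g y - y) ((totalDegree_sub _ _).trans
      (max_le (totalDegree_substP_le g hyd) hyd)) (by
        rw [map_sub]; exact Submodule.sub_mem _ (substP_mem_harmL2 g hyd hyH) hyH)
    rw [map_sub, inner_self_eq_zero] at h2
    exact sub_eq_zero.1 h2
  -- Thus y restricts to a symmetric eigenfunction for μ_{M+1}, and `hG` forces it to vanish on the
  -- sphere.
  have hmem : (polyC y : Sph N → ℝ) ∈ symEigenspace G (sphEig N (M + 1)) := by
    refine ⟨smoothSph_polyC y, fun θ => ?_, fun g hg θ => ?_⟩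
    · have h1 : pL (sphT y) = pL (-(sphEig N (M + 1) • y)) := by
        rw [pL_sphT_eq hyd hyH.2, map_neg, map_smul]
      rw [sphLap_polyC, pev_eq_of_pL_eq h1, polyC_apply]
      simp [pev]
    · have h1 := pev_eq_of_pL_eq (hfix g hg) θ
      rw [pev_substP] at h1
      rw [polyC_apply, polyC_apply]
      exact h1
  rw [hG, Submodule.mem_bot] at hmem
  have hy0 : pL y = 0 := by
    rw [← map_zero pL]
    refine pL_congr fun θ => ?_
    rw [← polyC_apply, hmem]; simp
  rw [hrep p hp, hy0, inner_zero_left]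

/-- Induction on the degree peels off one space of harmonics at a time. Degree 0 may carry
invariants, and is removed by orthogonality to constants. -/
lemma functional_eq_zero {G : Subgroup (E N ≃ₗᵢ[ℝ] E N)} {m : ℕ}
    (hG : ∀ i, 1 ≤ i → i ≤ m → symEigenspace G (sphEig N i) = ⊥)
    (ℓ : MvPolynomial (Fin N) ℝ →ₗ[ℝ] ℝ) (hℓ : ∀ p q, pL p = pL q → ℓ p = ℓ q)
    (hinv : ∀ g ∈ G, ∀ p, ℓ (substP g p) = ℓ p) :
    ∀ p : MvPolynomial (Fin N) ℝ, p.totalDegree ≤ m → ⟪pL 1, pL p⟫_ℝ = 0 → ℓ p = 0 := by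
  induction m with
  | zero =>
    intro p hp h1
    have hpC : p = (p.coeff 0) • (1 : MvPolynomial (Fin N) ℝ) := by
      conv_lhs => rw [totalDegree_eq_zero_iff_eq_C.1 (Nat.le_zero.1 hp)]
      rw [smul_eq_C_mul, mul_one]
    have h2 : ⟪pL p, pL p⟫_ℝ = 0 := by
      nth_rewrite 1 [hpC]
      rw [map_smul, real_inner_smul_left, h1, mul_zero]
    rw [hℓ p 0 (by rw [map_zero]; exact inner_self_eq_zero.1 h2), map_zero]
  | succ m ih =>
    intro p hp h1
    obtain ⟨q, hq, hqp⟩ := exists_pL_eq_starProjection m (pL p)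
    have hd : (p - q).totalDegree ≤ m + 1 :=
      (totalDegree_sub _ _).trans (max_le hp (hq.trans (Nat.le_succ m)))
    have ho : pL (p - q) ∈ (polyL2 N m)ᗮ := by
      rw [map_sub, hqp]; exact Submodule.sub_starProjection_mem_orthogonal _
    have h2 : ℓ (p - q) = 0 :=
      functional_eq_zero_of_mem_harmL2 (hG (m + 1) (by omega) le_rfl) ℓ hℓ hinv ⟨pL_mem hd, ho⟩
    have h3 : ⟪pL 1, pL (p - q)⟫_ℝ = 0 := ho _ (pL_mem (by simp))
    have h4 : ℓ q = 0 := by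
      refine ih (fun i hi him => hG i hi (him.trans (Nat.le_succ m))) q hq ?_
      rw [map_sub, inner_sub_right, h1] at h3
      linarith
    rw [map_sub, h4, sub_zero] at h2
    exact h2

lemma continuous_bounded_dir (p : MvPolynomial (Fin N) ℝ) :
    Measurable (fun x : E N => pev p (‖x‖⁻¹ • x)) ∧ ∃ B, ∀ x : E N, ‖pev p (‖x‖⁻¹ • x)‖ ≤ B := by
  refine ⟨(continuous_pev p).measurable.comp (by fun_prop), ?_⟩
  obtain ⟨B, hB⟩ := (isCompact_closedBall (0 : E N) 1).exists_bound_of_continuousOn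
    (continuous_pev p).continuousOn
  refine ⟨B, fun x => hB _ ?_⟩
  rw [mem_closedBall_zero_iff, norm_smul, norm_inv, norm_norm]
  exact inv_mul_le_one

/-- An integrable invariant function has no angular components of low positive degree. -/
lemma integral_mul_pev_dir_eq_zero {G : Subgroup (E N ≃ₗᵢ[ℝ] E N)} {m : ℕ}
    (hG : ∀ i, 1 ≤ i → i ≤ m → symEigenspace G (sphEig N i) = ⊥)
    {ν : Measure (E N)} (hν : ∀ g ∈ G, MeasurePreserving g ν ν) (hν0 : ∀ᵐ x ∂ν, x ≠ 0)
    {χ : E N → ℝ} (hχ : Integrable χ ν) (hinv : ∀ g ∈ G, ∀ᵐ x ∂ν, χ (g x) = χ x)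
    {p : MvPolynomial (Fin N) ℝ} (hp : p.totalDegree ≤ m) (hp1 : ⟪pL 1, pL p⟫_ℝ = 0) :
    ∫ x, χ x * pev p (‖x‖⁻¹ • x) ∂ν = 0 := by
  have hint (q : MvPolynomial (Fin N) ℝ) : Integrable (fun x => χ x * pev q (‖x‖⁻¹ • x)) ν := by
    obtain ⟨h1, B, hB⟩ := continuous_bounded_dir q
    exact hχ.mul_bdd h1.aestronglyMeasurable (Eventually.of_forall hB)
  -- Integrating χ against angular polynomials over all of ν gives a G-invariant functional
  -- directly, with no need to slice χ, defined only almost everywhere, into spheres.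
  let ℓ : MvPolynomial (Fin N) ℝ →ₗ[ℝ] ℝ :=
    { toFun := fun q => ∫ x, χ x * pev q (‖x‖⁻¹ • x) ∂ν
      map_add' := fun q r => by
        rw [← integral_add (hint q) (hint r)]
        simp_rw [pev_add, mul_add]
      map_smul' := fun c q => by
        rw [RingHom.id_apply, smul_eq_mul, ← integral_const_mul]
        simp_rw [pev_smul, mul_left_comm] }
  refine functional_eq_zero hG ℓ (fun q r hqr => ?_) (fun g hg q => ?_) p hp hp1
  · refine integral_congr_ae ?_
    filter_upwards [hν0] with x hx
    have := pev_eq_of_pL_eq hqr ⟨‖x‖⁻¹ • x, by simp [norm_smul, hx]⟩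
    simp only at this
    rw [this]
  · change ∫ x, χ x * pev (substP g q) (‖x‖⁻¹ • x) ∂ν = ∫ x, χ x * pev q (‖x‖⁻¹ • x) ∂ν
    rw [← (hν g hg).integral_comp g.toHomeomorph.measurableEmbedding
      (fun x => χ x * pev q (‖x‖⁻¹ • x))]
    refine integral_congr_ae ?_
    filter_upwards [hinv g hg] with x hx
    rw [hx, pev_substP, map_smul, g.norm_map]

end

/-! ### Polar coordinates and integrability on the exterior domain. -/

/-- Integration in polar coordinates. -/
lemma integral_polar {N : ℕ} (hN : 2 ≤ N) {g : E N → ℝ} (hg : Integrable g) :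
    ∫ x, g x = ∫ r in Set.Ioi (0 : ℝ), r ^ (N - 1) * ∫ θ : Sph N, g (r • (θ : E N)) ∂(sphMeas N) := by
  have : Nontrivial (E N) := by
    apply Module.nontrivial_of_finrank_pos (R := ℝ)
    simp; omega
  have hdim : Module.finrank ℝ (E N) = N := by simp
  have hmp := (volume : Measure (E N)).measurePreserving_homeomorphUnitSphereProd
  have hemb : MeasurableEmbedding (homeomorphUnitSphereProd (E N)) :=
    (homeomorphUnitSphereProd (E N)).measurableEmbedding
  let H : Sph N × Set.Ioi (0 : ℝ) → ℝ := fun z => g (z.2.1 • (z.1 : E N))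
  have hH (x : ({0}ᶜ : Set (E N))) : H (homeomorphUnitSphereProd (E N) x) = g x := by
    have := congrArg Subtype.val ((homeomorphUnitSphereProd (E N)).symm_apply_apply x)
    simp only [H]
    rw [← homeomorphUnitSphereProd_symm_apply_coe]
    rw [this]
  have h1 : ∫ x, g x = ∫ z, H z ∂((sphMeas N).prod (Measure.volumeIoiPow (N - 1))) := by
    rw [← restrict_compl_singleton (μ := (volume : Measure (E N))) 0,
      ← integral_subtype_comap (measurableSet_singleton _).compl]
    have := hmp.integral_comp hemb H
    rw [hdim] at this
    simp_rw [hH] at this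
    exact this
  have hint : Integrable H ((sphMeas N).prod (Measure.volumeIoiPow (N - 1))) := by
    have h2 := hmp.integrable_comp_emb hemb (g := H)
    rw [hdim] at h2
    refine h2.1 ?_
    have h3 : H ∘ (homeomorphUnitSphereProd (E N)) = g ∘ Subtype.val := funext hH
    rw [h3, ← integrableOn_iff_comap_subtypeVal (measurableSet_singleton _).compl]
    exact hg.integrableOn
  rw [h1, integral_prod_symm _ hint]
  simp only [Measure.volumeIoiPow, ENNReal.ofReal, H]
  rw [integral_withDensity_eq_integral_smul,
    integral_subtype_comap measurableSet_Ioi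
      fun a => Real.toNNReal (a ^ (N - 1)) • ∫ θ : Sph N, g (a • (θ : E N)) ∂(sphMeas N)]
  · refine setIntegral_congr_fun measurableSet_Ioi fun r hr => ?_
    rw [NNReal.smul_def, Real.coe_toNNReal _ (pow_nonneg (le_of_lt hr) _), smul_eq_mul]
  · exact (measurable_subtype_coe.pow_const _).real_toNNReal

lemma measurableSet_extBall (N : ℕ) (R : ℝ) : MeasurableSet (extBall N R) :=
  measurableSet_lt measurable_const measurable_norm

lemma measurable_hypDensity (N : ℕ) :
    Measurable fun x : E N => (Real.sinh ‖x‖ / ‖x‖) ^ (N - 1) := by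
  have := Real.measurable_sinh
  fun_prop

lemma hypDensity_nonneg {N : ℕ} (x : E N) : 0 ≤ (Real.sinh ‖x‖ / ‖x‖) ^ (N - 1) :=
  pow_nonneg (div_nonneg (Real.sinh_nonneg_iff.2 (norm_nonneg x)) (norm_nonneg x)) _

lemma integrableOn_hypVol_iff {N : ℕ} {R : ℝ} {F : E N → ℝ} :
    IntegrableOn F (extBall N R) (hypVol N)
      ↔ IntegrableOn (fun x => (Real.sinh ‖x‖ / ‖x‖) ^ (N - 1) * F x) (extBall N R) := by
  rw [IntegrableOn, hypVol, restrict_withDensity (measurableSet_extBall N R),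
    integrable_withDensity_iff_integrable_smul' (measurable_hypDensity N).ennreal_ofReal
      (Eventually.of_forall fun _ => ENNReal.ofReal_lt_top)]
  simp_rw [ENNReal.toReal_ofReal (hypDensity_nonneg _), smul_eq_mul]
  rfl

lemma setIntegral_hypVol {N : ℕ} {R : ℝ} (F : E N → ℝ) :
    ∫ x in extBall N R, F x ∂(hypVol N)
      = ∫ x in extBall N R, (Real.sinh ‖x‖ / ‖x‖) ^ (N - 1) * F x := by
  rw [hypVol, restrict_withDensity (measurableSet_extBall N R),
    integral_withDensity_eq_integral_toReal_smul (measurable_hypDensity N).ennreal_ofReal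
      (Eventually.of_forall fun _ => ENNReal.ofReal_lt_top)]
  simp_rw [ENNReal.toReal_ofReal (hypDensity_nonneg _), smul_eq_mul]

/-- Continuity is asked only off the origin, where angular factors and `gradSq` may be singular; R >
0 keeps the integral on a compact annulus. -/
lemma integrableOn_extBall {N : ℕ} {R K : ℝ} (hR : 0 < R) {F : E N → ℝ}
    (hF : ContinuousOn F {0}ᶜ) (hK : ∀ x, K ≤ ‖x‖ → F x = 0) :
    IntegrableOn F (extBall N R) (hypVol N) := by
  rw [integrableOn_hypVol_iff]
  set S : Set (E N) := closedBall 0 K ∩ {x | R ≤ ‖x‖}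
  have hS : IsCompact S :=
    (isCompact_closedBall 0 K).inter_right (isClosed_le continuous_const continuous_norm)
  have hS0 : S ⊆ {0}ᶜ := fun x hx h0 => by
    rw [Set.mem_singleton_iff.1 h0] at hx
    have := hx.2
    simp at this; linarith
  have hc : ContinuousOn (fun x : E N => (Real.sinh ‖x‖ / ‖x‖) ^ (N - 1) * F x) S := by
    refine ContinuousOn.mul (ContinuousOn.pow (ContinuousOn.div ?_ ?_ ?_) _) (hF.mono hS0)
    · exact (Real.continuous_sinh.comp continuous_norm).continuousOn
    · exact continuous_norm.continuousOn
    · exact fun x hx => norm_ne_zero_iff.2 (hS0 hx)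
  refine IntegrableOn.of_forall_sdiff_eq_zero (hc.integrableOn_compact hS)
    (measurableSet_extBall N R) fun x hx => ?_
  have hKx : K ≤ ‖x‖ := by
    by_contra hcon
    exact hx.2 ⟨by simpa using (not_le.1 hcon).le, le_of_lt (show R < ‖x‖ from hx.1)⟩
  rw [hK x hKx, mul_zero]

/-- Integration over the exterior domain in geodesic polar coordinates. -/
lemma setIntegral_extBall_polar {N : ℕ} (hN : 2 ≤ N) {R : ℝ} (hR : 0 < R) {F : E N → ℝ}
    (hF : IntegrableOn F (extBall N R) (hypVol N)) :
    ∫ x in extBall N R, F x ∂(hypVol N)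
      = ∫ r in Set.Ioi R, Real.sinh r ^ (N - 1)
          * ∫ θ : Sph N, F (r • (θ : E N)) ∂(sphMeas N) := by
  rw [integrableOn_hypVol_iff] at hF
  rw [setIntegral_hypVol, ← integral_indicator (measurableSet_extBall N R),
    integral_polar hN (hF.integrable_indicator (measurableSet_extBall N R)),
    ← Set.inter_eq_right.2 (Set.Ioi_subset_Ioi hR.le),
    ← setIntegral_indicator measurableSet_Ioi]
  refine setIntegral_congr_fun measurableSet_Ioi fun r hr => ?_
  have hr0 : 0 < r := hr
  have hn (θ : Sph N) : ‖r • (θ : E N)‖ = r := by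
    rw [norm_smul, mem_sphere_zero_iff_norm.1 θ.2, mul_one, Real.norm_of_nonneg hr0.le]
  by_cases hrR : R < r
  · have h1 (θ : Sph N) : r • (θ : E N) ∈ extBall N R := by simpa [extBall, hn θ] using hrR
    simp only [Set.indicator_of_mem (h1 _), hn, Set.indicator_of_mem (Set.mem_Ioi.2 hrR)]
    rw [integral_const_mul, ← mul_assoc, ← mul_pow, mul_div_cancel₀ _ hr0.ne']
  · have h1 (θ : Sph N) : r • (θ : E N) ∉ extBall N R := by simpa [extBall, hn θ] using hrR
    simp only [Set.indicator_of_notMem (h1 _),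
      Set.indicator_of_notMem (show r ∉ Set.Ioi R from hrR), integral_zero, mul_zero]

/-- The measure of the exterior domain is invariant under the isometries fixing the origin. -/
lemma measurePreserving_hypVol_restrict {N : ℕ} (R : ℝ) (g : E N ≃ₗᵢ[ℝ] E N) :
    MeasurePreserving g ((hypVol N).restrict (extBall N R))
      ((hypVol N).restrict (extBall N R)) := by
  have hemb : MeasurableEmbedding g := g.toHomeomorph.measurableEmbedding
  have h1 : MeasurePreserving g (hypVol N) (hypVol N) := by
    refine ⟨hemb.measurable, ?_⟩
    ext s hs
    rw [Measure.map_apply hemb.measurable hs, hypVol,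
      withDensity_apply _ (hemb.measurable hs), withDensity_apply _ hs,
      ← g.measurePreserving.setLIntegral_comp_preimage_emb hemb
        (fun x => ENNReal.ofReal ((Real.sinh ‖x‖ / ‖x‖) ^ (N - 1))) s]
    simp
  have h2 := h1.restrict_preimage_emb hemb (extBall N R)
  have h3 : g ⁻¹' extBall N R = extBall N R := by ext x; simp [extBall]
  rwa [h3] at h2

lemma ae_ne_zero_extBall {N : ℕ} {R : ℝ} (hR : 0 < R) :
    ∀ᵐ x ∂((hypVol N).restrict (extBall N R)), x ≠ 0 := by
  filter_upwards [ae_restrict_mem (measurableSet_extBall N R)] with x hx h0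
  rw [h0] at hx
  simp [extBall] at hx; linarith

lemma integrableOn_Ioi_of_continuousOn {R K : ℝ} {h : ℝ → ℝ} (hc : ContinuousOn h (Set.Ici R))
    (hK : ∀ r, K ≤ r → h r = 0) : IntegrableOn h (Set.Ioi R) := by
  have h1 : IntegrableOn h (Set.Icc R K) :=
    (hc.mono Set.Icc_subset_Ici_self).integrableOn_compact isCompact_Icc
  refine IntegrableOn.of_forall_sdiff_eq_zero h1 measurableSet_Ioi fun x hx => hK x ?_
  by_contra hcon
  exact hx.2 ⟨le_of_lt hx.1, (not_le.1 hcon).le⟩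

lemma continuous_integral_sph {N : ℕ} {F : ℝ → Sph N → ℝ}
    (hF : Continuous (Function.uncurry F)) :
    Continuous fun r => ∫ θ, F r θ ∂(sphMeas N) := by
  have := continuous_parametric_integral_of_continuous (μ := sphMeas N) hF isCompact_univ
  simpa using this

/-! ### Variance and energy on geodesic spheres. -/

section
variable {N : ℕ}

lemma sphMeas_real_univ_pos (hN : 2 ≤ N) : 0 < (sphMeas N).real Set.univ := by
  have : Nontrivial (E N) := by
    apply Module.nontrivial_of_finrank_pos (R := ℝ)
    simp; omega
  have h : sphMeas N ≠ 0 := Measure.toSphere_ne_zero _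
  have : NeZero (sphMeas N) := ⟨h⟩
  exact measureReal_univ_pos

/-- The Cauchy–Schwarz inequality against a constant. -/
lemma sq_integral_le_measureReal_mul {α : Type*} [MeasurableSpace α] {μ : Measure α}
    [IsFiniteMeasure μ] {h : α → ℝ} (h1 : Integrable h μ) (h2 : Integrable (fun x => h x ^ 2) μ) :
    (∫ x, h x ∂μ) ^ 2 ≤ μ.real Set.univ * ∫ x, h x ^ 2 ∂μ := by
  -- The quadratic y ↦ ∫ (h - y)² is nonnegative, so its discriminant is at most 0.
  have key : ∀ y : ℝ, 0 ≤ μ.real Set.univ * (y * y) + (-(2 * ∫ x, h x ∂μ)) * y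
      + ∫ x, h x ^ 2 ∂μ := by
    intro y
    have h3 : 0 ≤ ∫ x, (h x - y) ^ 2 ∂μ := integral_nonneg fun x => sq_nonneg _
    have e : ∀ x, (h x - y) ^ 2 = h x ^ 2 - 2 * y * h x + y ^ 2 := fun x => by ring
    simp_rw [e] at h3
    have i1 : Integrable (fun x => 2 * y * h x) μ := h1.const_mul _
    have i2 : Integrable (fun x => h x ^ 2 - 2 * y * h x) μ := h2.sub i1
    rw [integral_add i2 (integrable_const _), integral_sub h2 i1, integral_const_mul,
      integral_const, smul_eq_mul] at h3
    linarith
  have := discrim_le_zero key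
  rw [discrim] at this
  linarith

lemma sq_integral_le (hN : 2 ≤ N) {h : Sph N → ℝ} (hc : Continuous h) :
    (∫ θ, h θ ∂(sphMeas N)) ^ 2 / (sphMeas N).real Set.univ ≤ ∫ θ, h θ ^ 2 ∂(sphMeas N) := by
  rw [div_le_iff₀' (sphMeas_real_univ_pos hN)]
  exact sq_integral_le_measureReal_mul (integrable_of_continuous_sph hc)
    (integrable_of_continuous_sph (hc.pow 2))

/-- `∫ |φ - φ̄|² dθ` over the sphere of radius `r`, with `φ̄` the mean of `φ` on that sphere. -/
noncomputable def sphVar (φ : E N → ℝ) (r : ℝ) : ℝ :=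
  ∫ θ : Sph N, φ (r • (θ : E N)) ^ 2 ∂(sphMeas N)
    - (∫ θ : Sph N, φ (r • (θ : E N)) ∂(sphMeas N)) ^ 2 / (sphMeas N).real Set.univ

/-- The radial derivative of `sphVar`. -/
noncomputable def sphVarDeriv (φ : E N → ℝ) (r : ℝ) : ℝ :=
  2 * ∫ θ : Sph N, φ (r • (θ : E N)) * fderiv ℝ φ (r • (θ : E N)) θ ∂(sphMeas N)
    - 2 * (∫ θ : Sph N, φ (r • (θ : E N)) ∂(sphMeas N))
      * (∫ θ : Sph N, fderiv ℝ φ (r • (θ : E N)) θ ∂(sphMeas N)) / (sphMeas N).real Set.univ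

/-- The radial part of the energy on the sphere of radius `r`. -/
noncomputable def radEnergy (φ : E N → ℝ) (r : ℝ) : ℝ :=
  ∫ θ : Sph N, fderiv ℝ φ (r • (θ : E N)) θ ^ 2 ∂(sphMeas N)

/-- The angular part of the energy on the sphere of radius `r`. -/
noncomputable def angEnergy (φ : E N → ℝ) (r : ℝ) : ℝ :=
  1 / 2 * ∑ i, ∑ j, ∫ θ : Sph N,
    fderiv ℝ φ (r • (θ : E N)) (rotGen i j (r • (θ : E N))) ^ 2 ∂(sphMeas N)

variable {φ : E N → ℝ}

lemma continuous_slice (hφ : ContDiff ℝ 1 φ) :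
    Continuous fun z : ℝ × Sph N => φ (z.1 • (z.2 : E N)) :=
  hφ.continuous.comp (by fun_prop)

lemma continuous_slice_fderiv (hφ : ContDiff ℝ 1 φ) :
    Continuous fun z : ℝ × Sph N => fderiv ℝ φ (z.1 • (z.2 : E N)) z.2 :=
  ((hφ.continuous_fderiv one_ne_zero).comp (by fun_prop)).clm_apply (by fun_prop)

lemma hasDerivAt_slice (hφ : ContDiff ℝ 1 φ) (r : ℝ) (θ : Sph N) :
    HasDerivAt (fun s : ℝ => φ (s • (θ : E N))) (fderiv ℝ φ (r • (θ : E N)) θ) r := by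
  have h1 : HasDerivAt (fun s : ℝ => s • (θ : E N)) (θ : E N) r := by
    simpa using (hasDerivAt_id r).smul_const (θ : E N)
  exact (hφ.differentiable one_ne_zero _).hasFDerivAt.comp_hasDerivAt r h1

lemma hasDerivAt_sphVar (hφ : ContDiff ℝ 1 φ) (r : ℝ) :
    HasDerivAt (sphVar φ) (sphVarDeriv φ r) r := by
  have h1 := hasDerivAt_integral_sph (N := N) (F := fun r (θ : Sph N) => φ (r • (θ : E N)))
    (F' := fun r θ => fderiv ℝ φ (r • (θ : E N)) θ)
    (fun t => (continuous_slice hφ).comp (Continuous.prodMk_right t))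
    (continuous_slice_fderiv hφ) (fun t θ => hasDerivAt_slice hφ t θ) r
  have h2 := hasDerivAt_integral_sph (N := N) (F := fun r θ => φ (r • (θ : E N)) ^ 2)
    (F' := fun r θ => 2 * (φ (r • (θ : E N)) * fderiv ℝ φ (r • (θ : E N)) θ))
    (fun t => ((continuous_slice hφ).comp (Continuous.prodMk_right t)).pow 2)
    (by have := continuous_slice hφ; have := continuous_slice_fderiv hφ; simp only [Function.uncurry_def]; fun_prop)
    (fun t θ => by
      refine ((hasDerivAt_slice hφ t θ).pow 2).congr_deriv ?_
      norm_num; ring) r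
  refine (h2.sub ((h1.pow 2).div_const _)).congr_deriv ?_
  rw [integral_const_mul, sphVarDeriv]
  norm_num

lemma continuous_sphVar (hφ : ContDiff ℝ 1 φ) : Continuous (sphVar φ) :=
  continuous_iff_continuousAt.2 fun r => (hasDerivAt_sphVar hφ r).continuousAt

lemma continuous_sphVarDeriv (hφ : ContDiff ℝ 1 φ) : Continuous (sphVarDeriv φ) := by
  have h1 := continuous_integral_sph (F := fun r (θ : Sph N) => φ (r • (θ : E N))) (continuous_slice hφ)
  have h2 := continuous_integral_sph (F := fun r (θ : Sph N) => fderiv ℝ φ (r • (θ : E N)) θ)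
    (continuous_slice_fderiv hφ)
  have h3 := continuous_integral_sph
    (F := fun r (θ : Sph N) => φ (r • (θ : E N)) * fderiv ℝ φ (r • (θ : E N)) θ)
    ((continuous_slice hφ).mul (continuous_slice_fderiv hφ))
  unfold sphVarDeriv
  fun_prop

lemma continuous_radEnergy (hφ : ContDiff ℝ 1 φ) : Continuous (radEnergy φ) :=
  continuous_integral_sph (F := fun r (θ : Sph N) => fderiv ℝ φ (r • (θ : E N)) θ ^ 2)
    ((continuous_slice_fderiv hφ).pow 2)

lemma continuous_angEnergy (hφ : ContDiff ℝ 1 φ) : Continuous (angEnergy φ) := by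
  refine continuous_const.mul (continuous_finsetSum _ fun i _ => continuous_finsetSum _ fun j _ => ?_)
  refine continuous_integral_sph
    (F := fun r (θ : Sph N) => fderiv ℝ φ (r • (θ : E N)) (rotGen i j (r • (θ : E N))) ^ 2) ?_
  exact (((hφ.continuous_fderiv one_ne_zero).comp (by fun_prop)).clm_apply (by fun_prop)).pow 2

lemma sphVar_nonneg (hN : 2 ≤ N) (hφ : ContDiff ℝ 1 φ) (r : ℝ) : 0 ≤ sphVar φ r :=
  sub_nonneg.2 (sq_integral_le hN ((continuous_slice hφ).comp (Continuous.prodMk_right r)))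

lemma norm_smul_sph {r : ℝ} (hr : 0 ≤ r) (θ : Sph N) : ‖r • (θ : E N)‖ = r := by
  rw [norm_smul, mem_sphere_zero_iff_norm.1 θ.2, mul_one, Real.norm_of_nonneg hr]

/-- Nonnegativity of the variance of ∂_r φ + cφ, after discarding the squared mean of ∂_r φ. -/
lemma radEnergy_ge (hN : 2 ≤ N) (hφ : ContDiff ℝ 1 φ) (c r : ℝ) :
    -(c * sphVarDeriv φ r) - c ^ 2 * sphVar φ r ≤ radEnergy φ r := by
  have hu : Continuous fun θ : Sph N => φ (r • (θ : E N)) :=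
    (continuous_slice hφ).comp (Continuous.prodMk_right r)
  have hv : Continuous fun θ : Sph N => fderiv ℝ φ (r • (θ : E N)) θ :=
    (continuous_slice_fderiv hφ).comp (Continuous.prodMk_right r)
  have h := sq_integral_le hN (h := fun θ : Sph N => fderiv ℝ φ (r • (θ : E N)) θ + c * φ (r • (θ : E N)))
    (hv.add (continuous_const.mul hu))
  have e : ∀ θ : Sph N, (fderiv ℝ φ (r • (θ : E N)) θ + c * φ (r • (θ : E N))) ^ 2
      = fderiv ℝ φ (r • (θ : E N)) θ ^ 2
        + 2 * c * (φ (r • (θ : E N)) * fderiv ℝ φ (r • (θ : E N)) θ)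
        + c ^ 2 * φ (r • (θ : E N)) ^ 2 := fun θ => by ring
  have hI : ∫ θ : Sph N, (fderiv ℝ φ (r • (θ : E N)) θ + c * φ (r • (θ : E N))) ∂(sphMeas N)
      = ∫ θ : Sph N, fderiv ℝ φ (r • (θ : E N)) θ ∂(sphMeas N)
        + c * ∫ θ : Sph N, φ (r • (θ : E N)) ∂(sphMeas N) := by
    rw [integral_add, integral_const_mul]
    · exact integrable_of_continuous_sph hv
    · exact integrable_of_continuous_sph (continuous_const.mul hu)
  have hI2 : ∫ θ : Sph N, (fderiv ℝ φ (r • (θ : E N)) θ + c * φ (r • (θ : E N))) ^ 2 ∂(sphMeas N)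
      = ∫ θ : Sph N, fderiv ℝ φ (r • (θ : E N)) θ ^ 2 ∂(sphMeas N)
        + 2 * c * ∫ θ : Sph N, φ (r • (θ : E N)) * fderiv ℝ φ (r • (θ : E N)) θ ∂(sphMeas N)
        + c ^ 2 * ∫ θ : Sph N, φ (r • (θ : E N)) ^ 2 ∂(sphMeas N) := by
    simp_rw [e]
    rw [integral_add, integral_add, integral_const_mul, integral_const_mul]
    · exact integrable_of_continuous_sph (hv.pow 2)
    · exact integrable_of_continuous_sph (continuous_const.mul (hu.mul hv))
    · exact integrable_of_continuous_sph ((hv.pow 2).add (continuous_const.mul (hu.mul hv)))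
    · exact integrable_of_continuous_sph (continuous_const.mul (hu.pow 2))
  rw [hI, hI2] at h
  have h0 := sq_nonneg (∫ θ : Sph N, fderiv ℝ φ (r • (θ : E N)) θ ∂(sphMeas N))
  have hA := sphMeas_real_univ_pos hN
  have h1 := div_nonneg h0 hA.le
  unfold sphVarDeriv sphVar radEnergy
  set A := (sphMeas N).real Set.univ
  set u1 := ∫ θ : Sph N, φ (r • (θ : E N)) ∂(sphMeas N)
  set v1 := ∫ θ : Sph N, fderiv ℝ φ (r • (θ : E N)) θ ∂(sphMeas N)
  have h2 : (v1 + c * u1) ^ 2 / A = v1 ^ 2 / A + c * (2 * u1 * v1 / A) + c ^ 2 * (u1 ^ 2 / A) := by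
    field_simp; ring
  rw [h2] at h
  linarith

/-- By Lagrange's identity the rotation derivatives at x sum to |∇_θ φ|², each plane being counted
twice; this matches `angEnergy` with the Dirichlet form of the spectral gap. -/
lemma gradSq_gradient {x : E N} (hx : x ≠ 0) :
    gradSq x (gradient φ x) = (fderiv ℝ φ x (‖x‖⁻¹ • x)) ^ 2
      + 1 / 2 * (∑ i, ∑ j, fderiv ℝ φ x (rotGen i j x) ^ 2) / Real.sinh ‖x‖ ^ 2 := by
  have hx0 : ‖x‖ ≠ 0 := norm_ne_zero_iff.2 hx
  have hs : Real.sinh ‖x‖ ≠ 0 := (Real.sinh_pos_iff.2 (norm_pos_iff.2 hx)).ne'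
  have h1 (v : E N) : fderiv ℝ φ x v = ⟪gradient φ x, v⟫_ℝ := (inner_gradient_left ..).symm
  simp_rw [h1, sum_inner_rotGen_sq, gradSq_eq hx, real_inner_smul_right,
    real_inner_comm x (gradient φ x)]
  field_simp

lemma integral_gradSq_slice (hφ : ContDiff ℝ 1 φ) {r : ℝ} (hr : 0 < r) :
    ∫ θ : Sph N, gradSq (r • (θ : E N)) (gradient φ (r • (θ : E N))) ∂(sphMeas N)
      = radEnergy φ r + angEnergy φ r / Real.sinh r ^ 2 := by
  have hne (θ : Sph N) : r • (θ : E N) ≠ 0 := by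
    rw [← norm_ne_zero_iff, norm_smul_sph hr.le]; exact hr.ne'
  have hrot (i j : Fin N) : Continuous fun θ : Sph N =>
      fderiv ℝ φ (r • (θ : E N)) (rotGen i j (r • (θ : E N))) ^ 2 :=
    (((hφ.continuous_fderiv one_ne_zero).comp (by fun_prop)).clm_apply (by fun_prop)).pow 2
  have hv : Continuous fun θ : Sph N => fderiv ℝ φ (r • (θ : E N)) θ :=
    (continuous_slice_fderiv hφ).comp (Continuous.prodMk_right r)
  have e (θ : Sph N) : gradSq (r • (θ : E N)) (gradient φ (r • (θ : E N)))
      = fderiv ℝ φ (r • (θ : E N)) θ ^ 2 + (1 / 2 * (Real.sinh r ^ 2)⁻¹) *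
        ∑ i, ∑ j, fderiv ℝ φ (r • (θ : E N)) (rotGen i j (r • (θ : E N))) ^ 2 := by
    rw [gradSq_gradient (hne θ), norm_smul_sph hr.le, smul_smul, inv_mul_cancel₀ hr.ne', one_smul]
    ring
  simp_rw [e]
  have hsum (i : Fin N) : Continuous fun θ : Sph N =>
      ∑ j, fderiv ℝ φ (r • (θ : E N)) (rotGen i j (r • (θ : E N))) ^ 2 :=
    continuous_finsetSum _ fun j _ => hrot i j
  have hsum2 : Continuous fun θ : Sph N =>
      ∑ i, ∑ j, fderiv ℝ φ (r • (θ : E N)) (rotGen i j (r • (θ : E N))) ^ 2 :=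
    continuous_finsetSum _ fun i _ => hsum i
  rw [integral_add, integral_const_mul, integral_finsetSum _ fun i _ =>
    integrable_of_continuous_sph (hsum i)]
  · simp_rw [integral_finsetSum Finset.univ fun j _ => integrable_of_continuous_sph (hrot _ j)]
    rw [radEnergy, angEnergy]
    ring
  · exact integrable_of_continuous_sph (hv.pow 2)
  · exact integrable_of_continuous_sph (continuous_const.mul hsum2)

open MvPolynomial in
/-- An orthonormal family of polynomials of degree at most `m` orthogonal to the constants, which
together with the constants captures the projection onto degree at most `m`. -/
lemma exists_orthonormal_polynomials (hN : 2 ≤ N) (m : ℕ) :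
    ∃ (n : ℕ) (q : Fin n → MvPolynomial (Fin N) ℝ),
      (∀ k, (q k).totalDegree ≤ m ∧ ⟪pL 1, pL (q k)⟫_ℝ = 0 ∧ ‖pL (q k)‖ = 1) ∧
      ∀ x, ‖(polyL2 N m).starProjection x‖ ^ 2
        = ⟪pL 1, x⟫_ℝ ^ 2 / (sphMeas N).real Set.univ + ∑ k, ⟪pL (q k), x⟫_ℝ ^ 2 := by
  have hA := sphMeas_real_univ_pos hN
  set A := (sphMeas N).real Set.univ
  have h11 : ⟪(pL 1 : Lp ℝ 2 (sphMeas N)), pL 1⟫_ℝ = A := by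
    rw [inner_pL]; simp [A]
  let W : Submodule ℝ (Lp ℝ 2 (sphMeas N)) := polyL2 N m ⊓ (Submodule.span ℝ {pL 1})ᗮ
  have : FiniteDimensional ℝ W := Submodule.finiteDimensional_inf_left _ _
  have hW1 (w : Lp ℝ 2 (sphMeas N)) (hw : w ∈ W) : ⟪pL 1, w⟫_ℝ = 0 :=
    Submodule.mem_orthogonal_singleton_iff_inner_right.1 hw.2
  set b := stdOrthonormalBasis ℝ W
  have hb (k) : ∃ q : MvPolynomial (Fin N) ℝ, q.totalDegree ≤ m ∧ pL q = (b k : Lp ℝ 2 _) :=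
    mem_polyL2.1 (b k).2.1
  choose q hq hqb using hb
  refine ⟨_, q, fun k => ⟨hq k, ?_, ?_⟩, fun x => ?_⟩
  · rw [hqb]; exact hW1 _ (b k).2
  · rw [hqb]; exact b.orthonormal.1 k
  · set u := (polyL2 N m).starProjection x with hu
    have hinner (y) (hy : y ∈ polyL2 N m) : ⟪y, u⟫_ℝ = ⟪y, x⟫_ℝ := by
      have : ⟪y, x - u⟫_ℝ = 0 := Submodule.sub_starProjection_mem_orthogonal x y hy
      rw [inner_sub_right] at this; linarith
    have h1m : (pL 1 : Lp ℝ 2 (sphMeas N)) ∈ polyL2 N m := pL_mem (by simp)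
    set c := ⟪pL 1, x⟫_ℝ / A with hc
    have hwW : u - c • pL 1 ∈ W := by
      refine ⟨Submodule.sub_mem _ (Submodule.starProjection_apply_mem _ _)
        (Submodule.smul_mem _ _ h1m), Submodule.mem_orthogonal_singleton_iff_inner_right.2 ?_⟩
      rw [inner_sub_right, real_inner_smul_right, hinner _ h1m, h11, hc]
      field_simp
      ring
    set w := u - c • pL 1 with hw
    have huw : u = w + c • pL 1 := by rw [hw]; abel
    have hnw : ‖w‖ ^ 2 = ∑ k, ⟪pL (q k), x⟫_ℝ ^ 2 := by
      have h2 := b.sum_sq_norm_inner_right ⟨w, hwW⟩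
      simp only [Submodule.coe_inner, Submodule.coe_norm, Real.norm_eq_abs, sq_abs] at h2
      rw [← h2]
      refine Finset.sum_congr rfl fun k _ => ?_
      rw [← hqb k, hw, inner_sub_right, real_inner_smul_right, real_inner_comm (pL 1) (pL (q k)),
        hinner _ (pL_mem (hq k)), hqb, hW1 _ (b k).2]
      ring
    rw [huw, norm_add_sq_real, hnw, real_inner_smul_right, real_inner_comm, hW1 _ hwW, norm_smul,
      mul_pow, ← real_inner_self_eq_norm_sq (pL 1), h11, Real.norm_eq_abs, sq_abs, hc]
    field_simp
    ring

/-- The coefficient of `φ(r ·)` along a polynomial on the sphere. -/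
noncomputable def sphCoef (q : MvPolynomial (Fin N) ℝ) (φ : E N → ℝ) (r : ℝ) : ℝ :=
  ∫ θ : Sph N, pev q θ * φ (r • (θ : E N)) ∂(sphMeas N)

lemma continuous_sphCoef (q : MvPolynomial (Fin N) ℝ) (hφ : ContDiff ℝ 1 φ) :
    Continuous (sphCoef q φ) :=
  continuous_integral_sph (F := fun r (θ : Sph N) => pev q θ * φ (r • (θ : E N)))
    (((continuous_pev q).comp (continuous_subtype_val.comp continuous_snd)).mul
      (continuous_slice hφ))

/-- The angular energy controls the variance up to the components of low degree. -/
lemma angEnergy_ge (hN : 2 ≤ N) {m n : ℕ} {q : Fin n → MvPolynomial (Fin N) ℝ}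
    (hq : ∀ x, ‖(polyL2 N m).starProjection x‖ ^ 2
        = ⟪pL 1, x⟫_ℝ ^ 2 / (sphMeas N).real Set.univ + ∑ k, ⟪pL (q k), x⟫_ℝ ^ 2)
    (hφ : ContDiff ℝ 1 φ) (r : ℝ) :
    sphEig N (m + 1) * (sphVar φ r - ∑ k, sphCoef (q k) φ r ^ 2) ≤ angEnergy φ r := by
  have hsm : ContDiff ℝ 1 fun x : E N => φ (r • x) := hφ.comp (contDiff_const_smul r)
  let c : C(Sph N, ℝ) := ⟨fun θ => φ (r • (θ : E N)), hsm.continuous.comp continuous_subtype_val⟩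
  have h := spectral_gap hN m hsm c fun θ => rfl
  have hd (θ : Sph N) (v : E N) : fderiv ℝ (fun x : E N => φ (r • x)) θ v
      = fderiv ℝ φ (r • (θ : E N)) (r • v) := by
    have h1 : HasFDerivAt (fun x : E N => r • x) (r • ContinuousLinearMap.id ℝ (E N)) (θ : E N) :=
      (r • ContinuousLinearMap.id ℝ (E N)).hasFDerivAt
    have h2 := ((hφ.differentiable one_ne_zero (r • (θ : E N))).hasFDerivAt).comp (θ : E N) h1
    have h3 : fderiv ℝ (fun x : E N => φ (r • x)) θ = _ := h2.fderiv
    rw [h3]; simp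
  have hcoef (p : MvPolynomial (Fin N) ℝ) : ⟪pL p, toL2 c⟫_ℝ = sphCoef p φ r := by
    rw [pL_apply, inner_toL2]
    simp_rw [polyC_apply]
    rfl
  have hmean : sphCoef 1 φ r = ∫ θ : Sph N, φ (r • (θ : E N)) ∂(sphMeas N) := by
    simp [sphCoef]
  rw [hq, norm_toL2_sq] at h
  simp_rw [hcoef, hmean, hd, ← map_smul] at h
  rw [← sub_sub] at h
  exact h

end

/-! ### Test functions: compact support and finite energy. -/

section
variable {N : ℕ} {φ : E N → ℝ}

lemma exists_vanishing_radius (hs : HasCompactSupport φ) :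
    ∃ K : ℝ, ∀ x, K ≤ ‖x‖ → φ x = 0 ∧ fderiv ℝ φ x = 0 := by
  obtain ⟨K, hK⟩ := hs.isCompact.isBounded.subset_ball (0 : E N)
  refine ⟨K, fun x hx => ?_⟩
  have h : x ∉ tsupport φ := fun h => by
    have := hK h
    rw [mem_ball_zero_iff] at this
    linarith
  exact ⟨image_eq_zero_of_notMem_tsupport h,
    Function.notMem_support.1 fun h' => h (support_fderiv_subset ℝ h')⟩

lemma continuous_gradient (hφ : ContDiff ℝ 1 φ) : Continuous (gradient φ) :=
  (InnerProductSpace.toDual ℝ (E N)).symm.continuous.comp (hφ.continuous_fderiv one_ne_zero)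

lemma gradSq_zero (x : E N) : gradSq x 0 = 0 := by
  simp [gradSq, hypGrad, hypMetric]

lemma gradient_eq_zero {x : E N} (h : fderiv ℝ φ x = 0) : gradient φ x = 0 := by
  rw [gradient, h, map_zero]

lemma continuousOn_gradSq_gradient (hφ : ContDiff ℝ 1 φ) :
    ContinuousOn (fun x => gradSq x (gradient φ x)) {0}ᶜ := by
  have hg := (continuous_gradient hφ).continuousOn (s := {0}ᶜ)
  have hsinh := Real.continuous_sinh
  have h : ContinuousOn (fun x : E N => (⟪x, gradient φ x⟫_ℝ / ‖x‖) ^ 2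
      + (‖x‖ / Real.sinh ‖x‖) ^ 2 * (‖gradient φ x‖ ^ 2 - (⟪x, gradient φ x⟫_ℝ / ‖x‖) ^ 2))
      {0}ᶜ := by
    have h1 : ∀ x ∈ ({0}ᶜ : Set (E N)), ‖x‖ ≠ 0 := fun x hx => norm_ne_zero_iff.2 hx
    have h2 : ∀ x ∈ ({0}ᶜ : Set (E N)), Real.sinh ‖x‖ ≠ 0 := fun x hx =>
      (Real.sinh_pos_iff.2 (norm_pos_iff.2 hx)).ne'
    have hq : ContinuousOn (fun x : E N => ⟪x, gradient φ x⟫_ℝ / ‖x‖) {0}ᶜ :=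
      (continuousOn_id.inner hg).div continuous_norm.continuousOn h1
    have hq2 : ContinuousOn (fun x : E N => ‖x‖ / Real.sinh ‖x‖) {0}ᶜ :=
      continuous_norm.continuousOn.div (hsinh.comp continuous_norm).continuousOn h2
    exact (hq.pow 2).add ((hq2.pow 2).mul ((hg.norm.pow 2).sub (hq.pow 2)))
  exact h.congr fun x hx => gradSq_eq hx _

lemma integrableOn_gradSq_gradient (hφ : ContDiff ℝ 1 φ) (hs : HasCompactSupport φ) {R : ℝ}
    (hR : 0 < R) : IntegrableOn (fun x => gradSq x (gradient φ x)) (extBall N R) (hypVol N) := by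
  obtain ⟨K, hK⟩ := exists_vanishing_radius hs
  refine integrableOn_extBall (K := K) hR (continuousOn_gradSq_gradient hφ) fun x hx => ?_
  rw [gradient_eq_zero (hK x hx).2, gradSq_zero]

lemma sphCoef_eq_zero {q : MvPolynomial (Fin N) ℝ} {K : ℝ} (hK : ∀ x, K ≤ ‖x‖ → φ x = 0)
    {r : ℝ} (hr0 : 0 ≤ r) (hr : K ≤ r) : sphCoef q φ r = 0 := by
  have h (θ : Sph N) : φ (r • (θ : E N)) = 0 := hK _ (by rwa [norm_smul_sph hr0])
  simp [sphCoef, h]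

end

/-! ### The energy inequality for test functions. -/

/-- The energy of a test function controls its variance on the boundary sphere, up to the
components of low degree. -/
lemma energy_ge {n m l : ℕ} {q : Fin l → MvPolynomial (Fin (n + 2)) ℝ}
    (hq : ∀ x, ‖(polyL2 (n + 2) m).starProjection x‖ ^ 2
        = ⟪pL 1, x⟫_ℝ ^ 2 / (sphMeas (n + 2)).real Set.univ + ∑ k, ⟪pL (q k), x⟫_ℝ ^ 2)
    {a : ℝ} (ha : 0 ≤ a) (hμ : a * (a - n) ≤ sphEig (n + 2) (m + 1))
    {φ : E (n + 2) → ℝ} (hφ : ContDiff ℝ 1 φ) (hs : HasCompactSupport φ) {R : ℝ} (hR : 0 < R) :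
    a * (Real.sinh R ^ n * sphVar φ R) - sphEig (n + 2) (m + 1) / Real.sinh R ^ 2
        * ∑ k, ∫ r in Set.Ioi R, Real.sinh r ^ (n + 1) * sphCoef (q k) φ r ^ 2
      ≤ ∫ x in extBall (n + 2) R, gradSq x (gradient φ x) ∂(hypVol (n + 2)) := by
  have hN : 2 ≤ n + 2 := by omega
  set μ := sphEig (n + 2) (m + 1) with hμdef
  have hμ0 : 0 ≤ μ := by
    have := sphEig_mono hN (Nat.zero_le (m + 1))
    have h0 : sphEig (n + 2) 0 = 0 := by simp [sphEig]
    rwa [h0] at this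
  obtain ⟨K, hK⟩ := exists_vanishing_radius hs
  have hz {r : ℝ} (hr0 : 0 ≤ r) (hr : K ≤ r) (θ : Sph (n + 2)) :
      φ (r • (θ : E (n + 2))) = 0 ∧ fderiv ℝ φ (r • (θ : E (n + 2))) = 0 :=
    hK _ (by rwa [norm_smul_sph hr0])
  -- The maximum with 0 ensures r ≥ 0, so that ‖rθ‖ = r.
  set K' := max K 0
  have hz' {r : ℝ} (hr : K' ≤ r) (θ : Sph (n + 2)) :
      φ (r • (θ : E (n + 2))) = 0 ∧ fderiv ℝ φ (r • (θ : E (n + 2))) = 0 :=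
    hz ((le_max_right K 0).trans hr) ((le_max_left K 0).trans hr) θ
  have zvar {r : ℝ} (hr : K' ≤ r) : sphVar φ r = 0 := by simp [sphVar, (hz' hr _).1]
  have zvd {r : ℝ} (hr : K' ≤ r) : sphVarDeriv φ r = 0 := by simp [sphVarDeriv, (hz' hr _).1]
  have zrad {r : ℝ} (hr : K' ≤ r) : radEnergy φ r = 0 := by simp [radEnergy, (hz' hr _).2]
  have zang {r : ℝ} (hr : K' ≤ r) : angEnergy φ r = 0 := by simp [angEnergy, (hz' hr _).2]
  have zcoef (k) {r : ℝ} (hr : K' ≤ r) : sphCoef (q k) φ r = 0 := by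
    simp [sphCoef, (hz' hr _).1]
  have cs := Real.continuous_sinh
  have cc := Real.continuous_cosh
  have c1 := continuous_sphVar hφ
  have c2 := continuous_sphVarDeriv hφ
  have c3 := continuous_radEnergy hφ
  have c4 := continuous_angEnergy hφ
  have c5 (k) := continuous_sphCoef (q k) hφ
  have sR : 0 < Real.sinh R := Real.sinh_pos_iff.2 hR
  have spos {r : ℝ} (hr : r ∈ Set.Ici R) : 0 < Real.sinh r :=
    Real.sinh_pos_iff.2 (hR.trans_le hr)
  let V' : ℝ → ℝ := fun r => (n : ℝ) * Real.sinh r ^ (n - 1) * Real.cosh r * sphVar φ r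
    + Real.sinh r ^ n * sphVarDeriv φ r
  have hV (r : ℝ) : HasDerivAt (fun r => Real.sinh r ^ n * sphVar φ r) (V' r) r :=
    ((Real.hasDerivAt_sinh r).pow n).mul (hasDerivAt_sphVar hφ r)
  have iV' : IntegrableOn V' (Set.Ioi R) :=
    integrableOn_Ioi_of_continuousOn (K := K') (by fun_prop)
      fun r hr => by simp [V', zvar hr, zvd hr]
  -- The boundary term of the theorem arises here: sinh^n Var vanishes for large r, leaving only its
  -- value at R.
  have hVint : ∫ r in Set.Ioi R, V' r = 0 - Real.sinh R ^ n * sphVar φ R := by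
    refine integral_Ioi_of_hasDerivAt_of_tendsto' (fun r _ => hV r) iV' ?_
    refine tendsto_const_nhds.congr' ?_
    filter_upwards [eventually_ge_atTop K'] with r hr
    rw [zvar hr, mul_zero]
  have iG : IntegrableOn (fun r => Real.sinh r ^ (n + 1)
      * (radEnergy φ r + angEnergy φ r / Real.sinh r ^ 2)) (Set.Ioi R) := by
    refine integrableOn_Ioi_of_continuousOn (K := K') ?_ fun r hr => by simp [zrad hr, zang hr]
    refine (by fun_prop : Continuous fun r => Real.sinh r ^ (n + 1)).continuousOn.mul
      (c3.continuousOn.add (c4.continuousOn.div (by fun_prop) fun r hr => ?_))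
    exact pow_ne_zero _ (spos hr).ne'
  have ie (k) : IntegrableOn (fun r => Real.sinh r ^ (n + 1) * sphCoef (q k) φ r ^ 2)
      (Set.Ioi R) := by
    have := c5 k
    exact integrableOn_Ioi_of_continuousOn (K := K') (by fun_prop) fun r hr => by
      simp [zcoef k hr]
  have hlhs : a * (Real.sinh R ^ n * sphVar φ R) - μ / Real.sinh R ^ 2
        * ∑ k, ∫ r in Set.Ioi R, Real.sinh r ^ (n + 1) * sphCoef (q k) φ r ^ 2
      = ∫ r in Set.Ioi R, (-a * V' r - μ / Real.sinh R ^ 2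
        * ∑ k, Real.sinh r ^ (n + 1) * sphCoef (q k) φ r ^ 2) := by
    rw [integral_sub (iV'.const_mul _) ((integrable_finsetSum _ fun k _ => ie k).const_mul _),
      integral_const_mul, integral_const_mul, integral_finsetSum _ fun k _ => ie k, hVint]
    ring
  have hrhs : ∫ x in extBall (n + 2) R, gradSq x (gradient φ x) ∂(hypVol (n + 2))
      = ∫ r in Set.Ioi R, Real.sinh r ^ (n + 1)
        * (radEnergy φ r + angEnergy φ r / Real.sinh r ^ 2) := by
    rw [setIntegral_extBall_polar hN hR (integrableOn_gradSq_gradient hφ hs hR)]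
    refine setIntegral_congr_fun measurableSet_Ioi fun r hr => ?_
    rw [integral_gradSq_slice hφ (hR.trans hr)]
    rfl
  rw [hlhs, hrhs]
  refine setIntegral_mono_on ((iV'.const_mul _).sub
    ((integrable_finsetSum _ fun k _ => ie k).const_mul _)) iG measurableSet_Ioi fun r hr => ?_
  have hs0 : 0 < Real.sinh r := spos (le_of_lt (Set.mem_Ioi.1 hr))
  have hsr : Real.sinh R ≤ Real.sinh r := Real.sinh_le_sinh.2 (le_of_lt hr)
  have hcosh := Real.one_le_cosh r
  have hva := sphVar_nonneg hN hφ r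
  -- With c = a / sinh r the loss c² Var scales like the angular energy: -a² from here and a(a - n)
  -- from the angular part leave -a n, the coefficient in -a (sinh^n Var)' apart from the factor
  -- cosh r.
  have h1 := radEnergy_ge hN hφ (a / Real.sinh r) r
  have h2 := angEnergy_ge hN hq hφ r
  rw [← hμdef, mul_sub] at h2
  set s := Real.sinh r
  set e := ∑ k, sphCoef (q k) φ r ^ 2 with he
  have he0 : 0 ≤ e := Finset.sum_nonneg fun k _ => sq_nonneg _
  have h3 : a * (a - n) * sphVar φ r - μ * e ≤ angEnergy φ r :=
    (sub_le_sub_right (mul_le_mul_of_nonneg_right hμ hva) _).trans h2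
  have h4 : s ^ (n + 1) * ((-(a / s * sphVarDeriv φ r) - (a / s) ^ 2 * sphVar φ r)
      + (a * (a - n) * sphVar φ r - μ * e) / s ^ 2)
      ≤ s ^ (n + 1) * (radEnergy φ r + angEnergy φ r / s ^ 2) :=
    mul_le_mul_of_nonneg_left (add_le_add h1 (div_le_div_of_nonneg_right h3 (sq_nonneg s)))
      (pow_nonneg hs0.le _)
  refine le_trans ?_ h4
  -- For n = 0 the exponent n - 1 truncates to 0, but the factor n vanishes.
  have hn1 : (n : ℝ) * s ^ (n + 1) / s ^ 2 = n * s ^ (n - 1) := by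
    rcases n with _ | k
    · simp
    · rw [Nat.add_sub_cancel]; field_simp; ring
  have h5 : s ^ (n + 1) * ((-(a / s * sphVarDeriv φ r) - (a / s) ^ 2 * sphVar φ r)
      + (a * (a - n) * sphVar φ r - μ * e) / s ^ 2)
      = -a * (s ^ n * sphVarDeriv φ r) - a * ((n * s ^ (n + 1) / s ^ 2) * sphVar φ r)
        - μ * (s ^ (n + 1) * e) / s ^ 2 := by
    field_simp; ring
  rw [h5, hn1, ← Finset.mul_sum, ← he]
  -- The factor cosh r ≥ 1 has the favourable sign, since this term enters with coefficient -a.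
  have h6 : (n : ℝ) * s ^ (n - 1) * sphVar φ r ≤ n * s ^ (n - 1) * Real.cosh r * sphVar φ r := by
    have : 0 ≤ (n : ℝ) * s ^ (n - 1) := by positivity
    nlinarith [mul_nonneg this hva]
  have h7 : μ * (s ^ (n + 1) * e) / s ^ 2 ≤ μ / Real.sinh R ^ 2 * (s ^ (n + 1) * e) := by
    rw [div_mul_eq_mul_div]
    have : 0 ≤ μ * (s ^ (n + 1) * e) := by positivity
    gcongr
  have h8 := mul_le_mul_of_nonneg_left h6 ha
  simp only [V']
  linarith

/-! ### Low-degree components of the approximating functions. -/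

section
variable {N : ℕ} {φ : E N → ℝ}

/-- The low degree components of a test function are controlled by its distance to any symmetric
function without such components. -/
lemma integral_sphCoef_sq_le (hN : 2 ≤ N) {G : Subgroup (E N ≃ₗᵢ[ℝ] E N)} {m : ℕ}
    (hG : ∀ i, 1 ≤ i → i ≤ m → symEigenspace G (sphEig N i) = ⊥)
    {q : MvPolynomial (Fin N) ℝ} (hqd : q.totalDegree ≤ m) (hq1 : ⟪pL 1, pL q⟫_ℝ = 0)
    (hqn : ‖pL q‖ = 1) (hφ : ContDiff ℝ 1 φ) (hs : HasCompactSupport φ) {R : ℝ} (hR : 0 < R)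
    {ψ : E N → ℝ} (hψ : MemLp ψ 2 ((hypVol N).restrict (extBall N R)))
    (hsym : IsSymmetric G R ψ) :
    ∫ r in Set.Ioi R, Real.sinh r ^ (N - 1) * sphCoef q φ r ^ 2
      ≤ ∫ x in extBall N R, (φ x - ψ x) ^ 2 ∂(hypVol N) := by
  obtain ⟨K, hK⟩ := exists_vanishing_radius hs
  set ν := (hypVol N).restrict (extBall N R) with hν
  set c := sphCoef q φ with hc
  have hcc : Continuous c := continuous_sphCoef q hφ
  have hcK (x : E N) (hx : K ≤ ‖x‖) : c ‖x‖ = 0 :=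
    sphCoef_eq_zero (fun y hy => (hK y hy).1) (norm_nonneg x) hx
  let Y : E N → ℝ := fun x => pev q (‖x‖⁻¹ • x)
  have hY : ContinuousOn Y {0}ᶜ := (continuous_pev q).comp_continuousOn
    ((continuous_norm.continuousOn.inv₀ fun x hx => norm_ne_zero_iff.2 hx).smul continuousOn_id)
  have hYr {r : ℝ} (hr : 0 < r) (θ : Sph N) : Y (r • (θ : E N)) = pev q θ := by
    simp only [Y]
    rw [norm_smul_sph hr.le, smul_smul, inv_mul_cancel₀ hr.ne', one_smul]
  have hcn : ContinuousOn (fun x : E N => c ‖x‖) {0}ᶜ :=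
    (hcc.comp continuous_norm).continuousOn
  have i1 : Integrable (fun x => c ‖x‖ * φ x * Y x) ν :=
    integrableOn_extBall (K := K) hR ((hcn.mul hφ.continuous.continuousOn).mul hY)
      fun x hx => by rw [hcK x hx, zero_mul, zero_mul]
  have i2 : Integrable (fun x => c ‖x‖ ^ 2 * Y x ^ 2) ν :=
    integrableOn_extBall (K := K) hR ((hcn.pow 2).mul (hY.pow 2))
      fun x hx => by rw [hcK x hx]; ring
  have i3 : MemLp (fun x : E N => c ‖x‖) 2 ν := by
    refine (memLp_two_iff_integrable_sq (hcc.comp continuous_norm).aestronglyMeasurable).2 ?_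
    exact integrableOn_extBall (K := K) hR (hcn.pow 2) fun x hx => by
      change c ‖x‖ ^ 2 = 0
      rw [hcK x hx]; ring
  have i4 : Integrable (fun x => c ‖x‖ * ψ x) ν := i3.integrable_mul hψ
  have i5 : Integrable (fun x => c ‖x‖ * ψ x * Y x) ν := by
    obtain ⟨h1, B, hB⟩ := continuous_bounded_dir q
    exact i4.mul_bdd h1.aestronglyMeasurable (Eventually.of_forall hB)
  have mφ : MemLp φ 2 ν := by
    refine (memLp_two_iff_integrable_sq hφ.continuous.aestronglyMeasurable).2 ?_
    exact integrableOn_extBall (K := K) hR (hφ.continuous.continuousOn.pow 2) fun x hx => by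
      rw [(hK x hx).1]; ring
  have i6 : Integrable (fun x => (φ x - ψ x) ^ 2) ν := (mφ.sub hψ).integrable_sq
  set A := ∫ r in Set.Ioi R, Real.sinh r ^ (N - 1) * c r ^ 2 with hA
  have e1 : ∫ x, c ‖x‖ * φ x * Y x ∂ν = A := by
    rw [hν, setIntegral_extBall_polar hN hR i1]
    refine setIntegral_congr_fun measurableSet_Ioi fun r hr => ?_
    have hr0 : 0 < r := hR.trans hr
    simp only [hYr hr0, norm_smul_sph hr0.le]
    simp_rw [mul_assoc, integral_const_mul, mul_comm (φ _)]
    rw [sq]; rfl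
  have e2 : ∫ x, c ‖x‖ ^ 2 * Y x ^ 2 ∂ν = A := by
    rw [hν, setIntegral_extBall_polar hN hR i2]
    refine setIntegral_congr_fun measurableSet_Ioi fun r hr => ?_
    have hr0 : 0 < r := hR.trans hr
    simp only [hYr hr0, norm_smul_sph hr0.le]
    have h1 : ∫ θ : Sph N, pev q θ ^ 2 ∂(sphMeas N) = 1 := by
      have := inner_pL q q
      rw [real_inner_self_eq_norm_sq, hqn] at this
      simp_rw [sq]; linarith
    rw [integral_const_mul, h1, mul_one]
  -- The radial factor c(‖x‖) preserves the symmetry of ψ and makes the product integrable.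
  have e3 : ∫ x, c ‖x‖ * ψ x * Y x ∂ν = 0 := by
    refine integral_mul_pev_dir_eq_zero (m := m) hG
      (fun g _ => measurePreserving_hypVol_restrict R g) (ae_ne_zero_extBall hR) i4
      (fun g hg => ?_) hqd hq1
    filter_upwards [hsym g hg] with x hx
    rw [g.norm_map, hx]
  have e4 : A = ∫ x, (c ‖x‖ * φ x * Y x - c ‖x‖ * ψ x * Y x) ∂ν := by
    rw [integral_sub i1 i5, e1, e3, sub_zero]
  -- Here A is both ∫ cY(φ - ψ) and ∫ (cY)², so 2uv ≤ u² + v² lets half of A be absorbed on the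
  -- left.
  have h5 : A ≤ ∫ x, (1 / 2 * (c ‖x‖ ^ 2 * Y x ^ 2) + 1 / 2 * (φ x - ψ x) ^ 2) ∂ν := by
    rw [e4]
    refine integral_mono (i1.sub i5) ((i2.const_mul _).add (i6.const_mul _)) fun x => ?_
    simp only
    nlinarith [sq_nonneg (c ‖x‖ * Y x - (φ x - ψ x))]
  rw [integral_add (i2.const_mul _) (i6.const_mul _), integral_const_mul, integral_const_mul,
    e2] at h5
  linarith

end

/-! ### Perturbation estimates for the energy and the boundary integral. -/

section
variable {N : ℕ}

lemma gradSq_nonneg {x : E N} (hx : x ≠ 0) (ξ : E N) : 0 ≤ gradSq x ξ := by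
  rw [gradSq_eq hx]
  have h : (⟪x, ξ⟫_ℝ / ‖x‖) ^ 2 ≤ ‖ξ‖ ^ 2 := by
    rw [div_pow, div_le_iff₀ (by positivity), ← sq_abs, ← mul_pow]
    exact pow_le_pow_left₀ (abs_nonneg _) ((abs_real_inner_le_norm x ξ).trans_eq (mul_comm _ _)) 2
  exact add_nonneg (sq_nonneg _) (mul_nonneg (sq_nonneg _) (sub_nonneg.2 h))

/-- Young's inequality for a nonnegative quadratic form: the defect equals `gradSq x (ε • ξ - η) /
ε`. -/
lemma gradSq_add_le {x : E N} (hx : x ≠ 0) {ε : ℝ} (hε : 0 < ε) (ξ η : E N) :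
    gradSq x (ξ + η) ≤ (1 + ε) * gradSq x ξ + (1 + 1 / ε) * gradSq x η := by
  have h0 := div_nonneg (gradSq_nonneg hx (ε • ξ - η)) hε.le
  have h1 : (1 + ε) * gradSq x ξ + (1 + 1 / ε) * gradSq x η - gradSq x (ξ + η)
      = gradSq x (ε • ξ - η) / ε := by
    simp only [gradSq_eq hx, norm_add_sq_real, norm_sub_sq_real, inner_add_right, inner_sub_right,
      real_inner_smul_right, real_inner_smul_left, norm_smul, mul_pow, Real.norm_eq_abs, sq_abs]
    field_simp
    ring
  linarith

lemma measurable_gradSq : Measurable fun z : E N × E N => gradSq z.1 z.2 := by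
  have := Real.measurable_sinh
  unfold gradSq hypMetric hypGrad
  fun_prop

lemma integrable_gradSq_sub {R : ℝ} (hR : 0 < R) {Φ Ψ : E N → E N}
    (hΦ : AEStronglyMeasurable Φ ((hypVol N).restrict (extBall N R)))
    (hΨ : AEStronglyMeasurable Ψ ((hypVol N).restrict (extBall N R)))
    (iΦ : IntegrableOn (fun x => gradSq x (Φ x)) (extBall N R) (hypVol N))
    (iΨ : IntegrableOn (fun x => gradSq x (Ψ x)) (extBall N R) (hypVol N)) :
    IntegrableOn (fun x => gradSq x (Φ x - Ψ x)) (extBall N R) (hypVol N) := by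
  refine Integrable.mono' ((iΦ.const_mul 2).add (iΨ.const_mul 2)) ?_ ?_
  · exact (measurable_gradSq.comp_aemeasurable
      (measurable_id.aemeasurable.prodMk (hΦ.sub hΨ).aemeasurable)).aestronglyMeasurable
  · filter_upwards [ae_ne_zero_extBall hR] with x hx
    rw [Real.norm_of_nonneg (gradSq_nonneg hx _), sub_eq_add_neg]
    have h1 := gradSq_add_le hx one_pos (Φ x) (-Ψ x)
    have h2 : gradSq x (-Ψ x) = gradSq x (Ψ x) := by
      rw [gradSq_eq hx, gradSq_eq hx, inner_neg_right, norm_neg]; ring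
    rw [h2] at h1
    norm_num at h1
    exact h1

lemma integral_gradSq_le {R : ℝ} (hR : 0 < R) {Φ Ψ : E N → E N}
    (iΦ : IntegrableOn (fun x => gradSq x (Φ x)) (extBall N R) (hypVol N))
    (iΨ : IntegrableOn (fun x => gradSq x (Ψ x)) (extBall N R) (hypVol N))
    (iΦΨ : IntegrableOn (fun x => gradSq x (Φ x - Ψ x)) (extBall N R) (hypVol N))
    {ε : ℝ} (hε : 0 < ε) :
    ∫ x in extBall N R, gradSq x (Φ x) ∂(hypVol N)
      ≤ (1 + ε) * ∫ x in extBall N R, gradSq x (Ψ x) ∂(hypVol N)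
        + (1 + 1 / ε) * ∫ x in extBall N R, gradSq x (Φ x - Ψ x) ∂(hypVol N) := by
  rw [← integral_const_mul, ← integral_const_mul,
    ← integral_add (iΨ.const_mul _) (iΦΨ.const_mul _)]
  refine integral_mono_ae iΦ ((iΨ.const_mul _).add (iΦΨ.const_mul _)) ?_
  filter_upwards [ae_ne_zero_extBall hR] with x hx
  have := gradSq_add_le hx hε (Ψ x) (Φ x - Ψ x)
  rwa [add_sub_cancel] at this

instance bdryMeas_isFiniteMeasure (N : ℕ) (R : ℝ) : IsFiniteMeasure (bdryMeas N R) := by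
  unfold bdryMeas
  exact Measure.smul_finite _ ENNReal.ofReal_ne_top

lemma integral_bdryMeas {R : ℝ} (hR : 0 < R) (f : Sph N → ℝ) :
    ∫ θ, f θ ∂(bdryMeas N R) = Real.sinh R ^ (N - 1) * ∫ θ, f θ ∂(sphMeas N) := by
  rw [bdryMeas, integral_smul_measure, ENNReal.toReal_ofReal
    (pow_nonneg (Real.sinh_nonneg_iff.2 hR.le) _), smul_eq_mul]

/-- A function of mean zero on `∂B_R` is controlled by the variance of a nearby function. -/
lemma integral_sq_le_sphVar (hN : 2 ≤ N) {R : ℝ} (hR : 0 < R) {t : Sph N → ℝ}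
    (ht : MemLp t 2 (bdryMeas N R)) (hmean : ∫ θ, t θ ∂(bdryMeas N R) = 0)
    {φ : E N → ℝ} (hφ : ContDiff ℝ 1 φ) {ε : ℝ} (hε : 0 < ε) :
    ∫ θ, t θ ^ 2 ∂(bdryMeas N R) ≤ (1 + ε) * (Real.sinh R ^ (N - 1) * sphVar φ R)
      + (2 + ε + 1 / ε) * ∫ θ : Sph N, (φ (R • (θ : E N)) - t θ) ^ 2 ∂(bdryMeas N R) := by
  have hA := sphMeas_real_univ_pos hN
  have hS : 0 < Real.sinh R ^ (N - 1) := pow_pos (Real.sinh_pos_iff.2 hR) _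
  set b := bdryMeas N R with hb
  let f : Sph N → ℝ := fun θ => φ (R • (θ : E N))
  have hfc : Continuous f := (continuous_slice hφ).comp (Continuous.prodMk_right R)
  have mf : MemLp f 2 b := by
    refine (memLp_two_iff_integrable_sq hfc.aestronglyMeasurable).2 ?_
    exact (hfc.pow 2).integrable_of_hasCompactSupport (HasCompactSupport.of_compactSpace _)
  have md : MemLp (fun θ => f θ - t θ) 2 b := mf.sub ht
  have i1 : Integrable f b := mf.integrable (by norm_num)
  have i2 : Integrable t b := ht.integrable (by norm_num)
  have h1 : ∫ θ, t θ ^ 2 ∂b ≤ (1 + ε) * ∫ θ, f θ ^ 2 ∂b + (1 + 1 / ε) * ∫ θ, (f θ - t θ) ^ 2 ∂b := by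
    rw [← integral_const_mul, ← integral_const_mul,
      ← integral_add (mf.integrable_sq.const_mul _) (md.integrable_sq.const_mul _)]
    refine integral_mono ht.integrable_sq
      ((mf.integrable_sq.const_mul _).add (md.integrable_sq.const_mul _)) fun θ => ?_
    simp only
    have h0 : 0 ≤ (ε * f θ + (f θ - t θ)) ^ 2 / ε := by positivity
    have h2 : (1 + ε) * f θ ^ 2 + (1 + 1 / ε) * (f θ - t θ) ^ 2 - t θ ^ 2
        = (ε * f θ + (f θ - t θ)) ^ 2 / ε := by
      field_simp; ring
    linarith
  -- As t has mean zero, the mean of f is that of f - t, hence small.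
  have h2 : (∫ θ, f θ ∂b) ^ 2 ≤ b.real Set.univ * ∫ θ, (f θ - t θ) ^ 2 ∂b := by
    have h3 := sq_integral_le_measureReal_mul (i1.sub i2) md.integrable_sq
    have h4 : ∫ θ, (f - t) θ ∂b = ∫ θ, f θ ∂b := by
      have := integral_sub i1 i2
      rw [hmean, sub_zero] at this
      exact this
    rw [h4] at h3
    exact h3
  have hbr : b.real Set.univ = Real.sinh R ^ (N - 1) * (sphMeas N).real Set.univ := by
    have := integral_bdryMeas hR (N := N) fun _ => (1 : ℝ)
    simpa using this
  rw [hbr, hb, integral_bdryMeas hR f, ← hb] at h2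
  have h5 : Real.sinh R ^ (N - 1) * ((∫ θ, f θ ∂(sphMeas N)) ^ 2 / (sphMeas N).real Set.univ)
      ≤ ∫ θ, (f θ - t θ) ^ 2 ∂b := by
    rw [← mul_div_assoc, div_le_iff₀ hA]
    nlinarith
  have h6 : ∫ θ, f θ ^ 2 ∂b = Real.sinh R ^ (N - 1) * sphVar φ R
      + Real.sinh R ^ (N - 1) * ((∫ θ, f θ ∂(sphMeas N)) ^ 2 / (sphMeas N).real Set.univ) := by
    rw [hb, integral_bdryMeas hR, sphVar]
    ring
  rw [h6] at h1
  have h7 := mul_le_mul_of_nonneg_left h5 (by positivity : (0 : ℝ) ≤ 1 + ε)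
  change _ ≤ _ + (2 + ε + 1 / ε) * ∫ θ, (f θ - t θ) ^ 2 ∂b
  linarith

end

/-! ### The arithmetic of (G1) and the conclusion. -/

/-- With i₁ = m + 1 and N = n + 2, squaring the bound on i₁ gives μ_{i₁} > (4/9)(N + 2)(N - 1),
which is a(a - n) for a = 4(N - 1)/3. Minimality of i₁ excludes the degrees 1, ..., m. -/
lemma G1.exists_gap {n : ℕ} {G : Subgroup (E (n + 2) ≃ₗᵢ[ℝ] E (n + 2))} (hG : G1 G) :
    ∃ m : ℕ, (∀ i, 1 ≤ i → i ≤ m → symEigenspace G (sphEig (n + 2) i) = ⊥) ∧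
      4 * ((n : ℝ) + 1) / 3 * (4 * ((n : ℝ) + 1) / 3 - n) ≤ sphEig (n + 2) (m + 1) := by
  obtain ⟨i₁, ⟨⟨h1, -⟩, hleast⟩, -, hgt⟩ := hG
  obtain ⟨m, rfl⟩ : ∃ m, i₁ = m + 1 := ⟨i₁ - 1, by omega⟩
  refine ⟨m, fun i hi him => ?_, ?_⟩
  · by_contra hne
    have := hleast ⟨hi, hne⟩
    omega
  · push_cast [sphEig] at hgt ⊢
    have hpos : (0 : ℝ) < 2 * (m + 1) + n := by positivity
    have h2 : √(((n : ℝ) + 2 - 2) ^ 2 + 16 / 9 * ((n : ℝ) + 2 + 2) * ((n : ℝ) + 2 - 1))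
        < 2 * (m + 1) + n := by linarith
    rw [Real.sqrt_lt' hpos] at h2
    nlinarith

end HypExt

open HypExt
theorem lemma3p3 (N : ℕ) (hN : 2 ≤ N)
    (p : ℝ) (hp : 1 < p) (hp' : 2 < N → p < ((N : ℝ) + 2) / ((N : ℝ) - 2))
    (R : ℝ) (hR : 0 < R)
    (G : Subgroup (E N ≃ₗᵢ[ℝ] E N)) (hG : G1 G)
    (ψ : E N → ℝ) (Ψ : E N → E N) (t : Sph N → ℝ)
    (hψ : MemH1 R ψ Ψ) (hsym : IsSymmetric G R ψ) (ht : IsTrace R ψ Ψ t)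
    (hmean : ∫ θ, t θ ∂(bdryMeas N R) = 0)
    (horth : ∫ x in extBall N R, ψ x * zR N p R x ∂(hypVol N) = 0) :
    1 / Real.sinh R * ∫ θ, t θ ^ 2 ∂(bdryMeas N R)
      ≤ 3 / (4 * ((N : ℝ) - 1)) * ∫ x in extBall N R, gradSq x (Ψ x) ∂(hypVol N) := by
  obtain ⟨n, rfl⟩ : ∃ n, N = n + 2 := ⟨N - 2, by omega⟩
  obtain ⟨m, hGm, hμ⟩ := hG.exists_gap
  obtain ⟨l, q, hq, hqP⟩ := exists_orthonormal_polynomials hN m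
  obtain ⟨htL, φ, hφ, hlim, hlimt⟩ := ht
  have hs : 0 < Real.sinh R := Real.sinh_pos_iff.2 hR
  set s := Real.sinh R with hsdef
  set a : ℝ := 4 * ((n : ℝ) + 1) / 3 with ha
  have ha0 : 0 < a := by positivity
  set μ := sphEig (n + 2) (m + 1)
  have hμ0 : 0 ≤ μ := by
    have := sphEig_mono hN (Nat.zero_le (m + 1))
    rwa [show sphEig (n + 2) 0 = 0 by simp [sphEig]] at this
  set 𝓔 := ∫ x in extBall (n + 2) R, gradSq x (Ψ x) ∂(hypVol (n + 2))
  set T := ∫ θ, t θ ^ 2 ∂(bdryMeas (n + 2) R)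
  set δ : ℕ → ℝ := fun j => ∫ x in extBall (n + 2) R,
    ((φ j x - ψ x) ^ 2 + gradSq x (gradient (φ j) x - Ψ x)) ∂(hypVol (n + 2))
  set τ : ℕ → ℝ := fun j =>
    ∫ θ : Sph (n + 2), (φ j (R • (θ : E (n + 2))) - t θ) ^ 2 ∂(bdryMeas (n + 2) R)
  -- One factor 1 + ε is the price of passing from t to φ_j on the boundary, the other of passing
  -- from the energy of φ_j to that of ψ. The l low components cost at most δ j each.
  have hstep (ε : ℝ) (hε : 0 < ε) (j : ℕ) : a / s * T ≤ (1 + ε) * ((1 + ε) * 𝓔)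
      + (1 + ε) * (1 + 1 / ε + μ / s ^ 2 * l) * δ j + a / s * (2 + ε + 1 / ε) * τ j := by
    have hφ1 : ContDiff ℝ 1 (φ j) := (hφ j).1.of_le (by exact_mod_cast le_top)
    have hφs := (hφ j).2
    have iΦ := integrableOn_gradSq_gradient hφ1 hφs hR
    have iD := integrable_gradSq_sub hR (continuous_gradient hφ1).aestronglyMeasurable
      hψ.aesm_grad iΦ hψ.integrable_grad
    have mφ : MemLp (φ j) 2 ((hypVol (n + 2)).restrict (extBall (n + 2) R)) := by
      obtain ⟨K, hK⟩ := exists_vanishing_radius hφs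
      refine (memLp_two_iff_integrable_sq hφ1.continuous.aestronglyMeasurable).2 ?_
      exact integrableOn_extBall (K := K) hR (hφ1.continuous.continuousOn.pow 2) fun x hx => by
        rw [(hK x hx).1]; ring
    have i2 := (mφ.sub hψ.memLp).integrable_sq
    have hδ : δ j = ∫ x in extBall (n + 2) R, (φ j x - ψ x) ^ 2 ∂(hypVol (n + 2))
        + ∫ x in extBall (n + 2) R, gradSq x (gradient (φ j) x - Ψ x) ∂(hypVol (n + 2)) :=
      integral_add i2 iD
    have hd0 : 0 ≤ ∫ x in extBall (n + 2) R, (φ j x - ψ x) ^ 2 ∂(hypVol (n + 2)) :=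
      integral_nonneg fun x => sq_nonneg _
    have hg0 : 0 ≤ ∫ x in extBall (n + 2) R, gradSq x (gradient (φ j) x - Ψ x) ∂(hypVol (n + 2)) :=
      integral_nonneg_of_ae ((ae_ne_zero_extBall hR).mono fun x hx => gradSq_nonneg hx _)
    have h1 := energy_ge hqP ha0.le hμ hφ1 hφs hR
    have h2 := integral_gradSq_le hR iΦ hψ.integrable_grad iD hε
    have h3 := integral_sq_le_sphVar hN hR htL hmean hφ1 hε
    have h4 : ∑ k, ∫ r in Set.Ioi R, Real.sinh r ^ (n + 1) * sphCoef (q k) (φ j) r ^ 2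
        ≤ l * δ j := by
      have : ∀ k ∈ Finset.univ, ∫ r in Set.Ioi R, Real.sinh r ^ (n + 1)
          * sphCoef (q k) (φ j) r ^ 2 ≤ δ j := fun k _ =>
        (integral_sphCoef_sq_le hN hGm (hq k).1 (hq k).2.1 (hq k).2.2 hφ1 hφs hR hψ.memLp
          hsym).trans (by linarith)
      simpa using Finset.sum_le_sum this
    have h5 := mul_le_mul_of_nonneg_left h4 (by positivity : 0 ≤ μ / s ^ 2)
    have h6 : a * (s ^ n * sphVar (φ j) R)
        ≤ (1 + ε) * 𝓔 + (1 + 1 / ε + μ / s ^ 2 * l) * δ j := by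
      have h7 : (1 + 1 / ε) * ∫ x in extBall (n + 2) R,
          gradSq x (gradient (φ j) x - Ψ x) ∂(hypVol (n + 2)) ≤ (1 + 1 / ε) * δ j :=
        mul_le_mul_of_nonneg_left (by linarith) (by positivity)
      linarith
    calc a / s * T ≤ a / s * ((1 + ε) * (s ^ (n + 1) * sphVar (φ j) R)
          + (2 + ε + 1 / ε) * τ j) := mul_le_mul_of_nonneg_left h3 (by positivity)
      _ = (1 + ε) * (a * (s ^ n * sphVar (φ j) R)) + a / s * (2 + ε + 1 / ε) * τ j := by
        field_simp; ring
      _ ≤ (1 + ε) * ((1 + ε) * 𝓔 + (1 + 1 / ε + μ / s ^ 2 * l) * δ j)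
          + a / s * (2 + ε + 1 / ε) * τ j := by gcongr
      _ = _ := by ring
  -- The limit j → ∞ is taken with ε fixed, because the error coefficients contain 1/ε; only then
  -- does ε tend to 0.
  have hε (ε : ℝ) (hε : 0 < ε) : a / s * T ≤ (1 + ε) * ((1 + ε) * 𝓔) := by
    have h := ((hlim.const_mul ((1 + ε) * (1 + 1 / ε + μ / s ^ 2 * l))).const_add
      ((1 + ε) * ((1 + ε) * 𝓔))).add (hlimt.const_mul (a / s * (2 + ε + 1 / ε)))
    simp only [mul_zero, add_zero] at h
    exact ge_of_tendsto' h (hstep ε hε)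
  have hmain : a / s * T ≤ 𝓔 := by
    have hc : Tendsto (fun ε : ℝ => (1 + ε) * ((1 + ε) * 𝓔)) (𝓝[>] 0) (𝓝 𝓔) := by
      have : Continuous fun ε : ℝ => (1 + ε) * ((1 + ε) * 𝓔) := by fun_prop
      have h := (this.tendsto 0).mono_left (nhdsWithin_le_nhds (s := Set.Ioi 0))
      simpa using h
    exact ge_of_tendsto hc (eventually_nhdsWithin_of_forall hε)
  have hfin : 1 / s * T = 1 / a * (a / s * T) := by field_simp
  have hca : 3 / (4 * (((n + 2 : ℕ) : ℝ) - 1)) = 1 / a := by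
    have h1 : ((n + 2 : ℕ) : ℝ) - 1 = n + 1 := by push_cast; ring
    rw [ha, h1]; field_simp
  rw [hfin, hca]
  exact mul_le_mul_of_nonneg_left hmain (by positivity)
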